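/- **Setting.** Let $\mathbb{F}_q$ be a finite field, let $Z=\{z_1,\dots,z_n\}$ with $n\ge 0$ be a set of independent variables, and for a field $F\supseteq\mathbb{F}_q$ let $F\{Z\}$ denote either the rational function field $F(Z)$ or the Laurent series field $F(\!(Z)\!)$ (the same choice for all $F$; for $n\ge 2$ the statement is claimed for both usual meanings of $F(\!(Z)\!)$: the fraction field of $F[[Z]]$, and iterated Laurent series). Let $f\in\mathbb{F}_q[t]$ be monic and irreducible of degree $d$, put $\mathbb{F}_f=\mathbb{F}_q[t]/(f)$, let $\overline{\mathbb{F}}_f$ be an algebraic closure of $\mathbb{F}_f$, and let $\bar\theta\in\mathbb{F}_f$ be a root of $f$. Let $\tau$ act on $\mathbb{F}_f\{Z\}$ and on $H:=\overline{\mathbb{F}}_f\{Z\}$ by raising all coefficients to the $q$-th power, and let $\sigma=\tau^{-1}$. Put $\mathcal{A}=\mathbb{F}_q\{Z\}[t]$. For $L=\mathbb{F}_f\{Z\}$ or $L=H$ let $L[\tau]$, $L[\sigma]$ be the twisted polynomial rings with $\tau c=\tau(c)\tau$ and $\sigma c=\sigma(c)\sigma$. For a square matrix $B=(B_{ij})$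 over $L[\tau]$ let $\partial B$ be its constant term with respect to $\tau$, and $B^*$ the matrix over $L[\sigma]$ with $(B^*)_{ij}=(B_{ji})^*$, where $(\sum_i b_i\tau^i)^*=\sum_i \sigma^i(b_i)\,\sigma^i$. Let $\mathcal{E}:\mathcal{A}\to \mathrm{Mat}_\ell(\mathbb{F}_f\{Z\}[\tau])$, $a\mapsto\mathcal{E}_a$, be an Anderson $t$-module of dimension $\ell$: an $\mathbb{F}_q\{Z\}$-algebra homomorphism such that $\partial\mathcal{E}_t-\bar\theta\,\mathrm{I}_\ell$ is nilpotent. For $L$ as above let $\mathcal{E}(L)$ be $L^\ell$ with the $\mathcal{A}$-module structure $a\cdot x=\mathcal{E}_a(x)$. The $t$-motive $\mathcal{M}_{\mathcal{E}}(H)=\mathrm{Mat}_{1\times\ell}(H[\tau])$ and the dual $t$-motive $\mathcal{N}_{\mathcal{E}}(H)=\mathrm{Mat}_{1\times\ell}(H[\sigma])$ are modules over $H[t]$, with $H$ acting by left multiplication and $t\cdot m=m\,\mathcal{E}_t$, $t\cdot n=n\,\mathcal{E}_t^*$. For nonzero $a \in \mathcal{A}$ let $\mathcal{E}[a]$ and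 $\mathcal{E}^*[a]$ be the kernels of $\mathcal{E}_a$ and $\mathcal{E}_a^*$ on $H^\ell$. If $\partial\mathcal{E}_a$ is invertible, they are said to have *full dimension* if their dimensions over $\mathbb{F}_q\{Z\}$ equal $\sum_i\deg_\tau d_i$, where $\mathrm{diag}(d_1,\dots,d_\ell)=U\mathcal{E}_aV$ with $U,V\in \mathrm{GL}_\ell(H[\tau])$. Let $\lambda\in\mathbb{F}_q[t]$ be monic and irreducible with $\lambda\neq f$. Let $\mathcal{A}_\lambda=\varprojlim\mathcal{A}/\lambda^m\mathcal{A}$ and let $T_\lambda(\mathcal{E})=\varprojlim\mathcal{E}[\lambda^m]$ be the Tate module, with transition maps $x\mapsto\mathcal{E}_\lambda(x)$. Assume that for some $r$: (a) $\mathcal{M}_{\mathcal{E}}(H)$ is free of rank $r$ over $H[t]$; (b) $\mathcal{N}_{\mathcal{E}}(H)$ is free of rank $r$ over $H[t]$; (c) $\mathcal{E}[\lambda^m]$ and $\mathcal{E}^*[\lambda^m]$ have full dimension for every $m\ge1$. **Theorem.** The $\mathcal{A}_\lambda$-module $T_\lambda(\mathcal{E})$ is free of rank $r$. Let $\mathrm{Char}(\tau^d,T_\lambda(\mathcal{E}),X)\in\mathcal{A}_\lambda[X]$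 be the characteristic polynomial of the $\mathcal{A}_\lambda$-linear endomorphism of $T_\lambda(\mathcal{E})$ induced by $x\mapsto\tau^d(x)$. Then $\mathrm{Char}(\tau^d,T_\lambda(\mathcal{E}),1)$ lies in $\mathcal{A}$, there is exactly one $\gamma\in\mathbb{F}_q\{Z\}^\times$ for which $\gamma\cdot\mathrm{Char}(\tau^d,T_\lambda(\mathcal{E}),1)$ is monic in $t$, and for this $\gamma$ $$\bigl[\mathcal{E}(\mathbb{F}_f\{Z\})\bigr]_{\mathcal{A}}=\gamma\cdot\mathrm{Char}(\tau^d,T_\lambda(\mathcal{E}),1),$$ where the $\mathcal{A}$-order $[M]_{\mathcal{A}}$ of a finitely generated torsion $\mathcal{A}$-module $M\cong\bigoplus_i\mathcal{A}/(f_i)$, with all $f_i$ monic in $t$, is $\prod_i f_i$. -/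

import Mathlib

open Polynomial

noncomputable section

namespace AndersonT

/-! ### The coefficient fields `F{Z}` -/

/-- Which field `F{Z}` in the variables `z_1, …, z_n` is used: rational functions `F(Z)`, or formal
Laurent series `F((Z))`. For `n ≥ 2` there are two usual fields with the latter name (they agree
for `n ≤ 1`): the fraction field of `F[[z_1, …, z_n]]`, and the field of iterated Laurent series,
that is, of series in monomials with exponents in `ℤ^n` whose support is well-ordered for the
lexicographic order. -/
inductive Kind where
  | rational
  | laurent
  | iterated

/-- A domain whose fraction field is `F{Z}`. (Iterated Laurent series already form a field.) -/
def Base (k : Kind) (n : ℕ) (F : Type*) [Field F] : Type _ :=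
  match k with
  | .rational => MvPolynomial (Fin n) F
  | .laurent => MvPowerSeries (Fin n) F
  | .iterated => HahnSeries (Lex (Fin n → ℤ)) F

namespace Base

variable (k : Kind) (n : ℕ) {F F' F'' : Type*} [Field F] [Field F'] [Field F'']

instance : CommRing (Base k n F) :=
  match k with
  | .rational => inferInstanceAs (CommRing (MvPolynomial (Fin n) F))
  | .laurent => inferInstanceAs (CommRing (MvPowerSeries (Fin n) F))
  | .iterated => inferInstanceAs (CommRing (HahnSeries (Lex (Fin n → ℤ)) F))

instance : IsDomain (Base k n F) :=
  match k with
  | .rational => inferInstanceAs (IsDomain (MvPolynomial (Fin n) F))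
  | .laurent =>
    haveI : IsDomain (MvPowerSeries (Fin n) F) := NoZeroDivisors.to_isDomain _
    inferInstanceAs (IsDomain (MvPowerSeries (Fin n) F))
  | .iterated => inferInstanceAs (IsDomain (HahnSeries (Lex (Fin n → ℤ)) F))

/-- Coefficientwise application of a homomorphism of fields to Hahn series. -/
def hahnMap {Γ : Type*} [AddCommGroup Γ] [LinearOrder Γ] [IsOrderedAddMonoid Γ]
    (g : F →+* F') : HahnSeries Γ F →+* HahnSeries Γ F' where
  toFun x := x.map g
  map_one' := by
    ext a
    simp only [HahnSeries.map_coeff, HahnSeries.coeff_one]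
    split_ifs <;> simp
  map_zero' := by ext a; simp
  map_add' x y := by ext a; simp
  map_mul' x y := by
    ext a
    have h : ∀ z : HahnSeries Γ F, (z.map g).support = z.support := fun z => by
      ext i; simp
    simp only [HahnSeries.map_coeff, HahnSeries.coeff_mul, map_sum, map_mul]
    refine Finset.sum_congr ?_ fun _ _ => rfl
    ext i
    simp only [Finset.mem_antidiagonal, h]

/-- Coefficientwise application of a homomorphism of fields. -/
def map (g : F →+* F') : Base k n F →+* Base k n F' :=
  match k with
  | .rational => (MvPolynomial.map g : MvPolynomial (Fin n) F →+* MvPolynomial (Fin n) F')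
  | .laurent => (MvPowerSeries.map g : MvPowerSeries (Fin n) F →+* MvPowerSeries (Fin n) F')
  | .iterated => (hahnMap g :
      HahnSeries (Lex (Fin n → ℤ)) F →+* HahnSeries (Lex (Fin n → ℤ)) F')

/-- Constants. -/
def const : F →+* Base k n F :=
  match k with
  | .rational => (MvPolynomial.C : F →+* MvPolynomial (Fin n) F)
  | .laurent => (MvPowerSeries.C : F →+* MvPowerSeries (Fin n) F)
  | .iterated => (HahnSeries.C : F →+* HahnSeries (Lex (Fin n → ℤ)) F)

lemma map_injective (g : F →+* F') : Function.Injective (map k n g) := by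
  cases k with
  | rational => exact MvPolynomial.map_injective g g.injective
  | laurent =>
    intro x y h
    refine MvPowerSeries.ext fun a => g.injective ?_
    exact congrArg (fun z : MvPowerSeries (Fin n) F' => MvPowerSeries.coeff a z) h
  | iterated =>
    intro x y h
    refine HahnSeries.ext (funext fun a => g.injective ?_)
    exact congrArg (fun z : HahnSeries (Lex (Fin n → ℤ)) F' => z.coeff a) h

lemma map_id (x : Base k n F) : map k n (RingHom.id F) x = x := by
  cases k with
  | rational => exact MvPolynomial.map_id x
  | laurent => exact congrFun (congrArg DFunLike.coe (MvPowerSeries.map_id)) x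
  | iterated => rfl

lemma map_map (g : F →+* F') (g' : F' →+* F'') (x : Base k n F) :
    map k n g' (map k n g x) = map k n (g'.comp g) x := by
  cases k with
  | rational => exact MvPolynomial.map_map g g' x
  | laurent => rfl
  | iterated => rfl

end Base

/-- The field `F{Z}`. -/
def ZField (k : Kind) (n : ℕ) (F : Type*) [Field F] : Type _ := FractionRing (Base k n F)

namespace ZField

variable (k : Kind) (n : ℕ)

instance (F : Type*) [Field F] : Field (ZField k n F) :=
  inferInstanceAs (Field (FractionRing (Base k n F)))

instance (F : Type*) [Field F] : Algebra (Base k n F) (ZField k n F) :=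
  inferInstanceAs (Algebra (Base k n F) (FractionRing (Base k n F)))

instance (F : Type*) [Field F] : IsFractionRing (Base k n F) (ZField k n F) :=
  inferInstanceAs (IsFractionRing (Base k n F) (FractionRing (Base k n F)))

section maps

variable {F F' F'' : Type*} [Field F] [Field F'] [Field F'']

/-- The embedding `F → F{Z}` of the constants. -/
def const (F : Type*) [Field F] : F →+* ZField k n F :=
  (algebraMap (Base k n F) (ZField k n F)).comp (Base.const k n)

/-- The map `F{Z} → F'{Z}` which applies a homomorphism of fields to all coefficients. -/
def map (g : F →+* F') : ZField k n F →+* ZField k n F' :=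
  IsFractionRing.map (K := ZField k n F) (L := ZField k n F') (Base.map_injective k n g)

lemma map_algebraMap (g : F →+* F') (x : Base k n F) :
    map k n g (algebraMap (Base k n F) (ZField k n F) x) =
      algebraMap (Base k n F') (ZField k n F') (Base.map k n g x) :=
  IsLocalization.map_eq (M := nonZeroDivisors (Base k n F)) (T := nonZeroDivisors (Base k n F'))
    (S := ZField k n F) (Q := ZField k n F') (g := Base.map k n g)
    (nonZeroDivisors_le_comap_nonZeroDivisors_of_injective _ (Base.map_injective k n g)) x

lemma hom_ext {R : Type*} [CommRing R] {φ ψ : ZField k n F →+* R}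
    (h : ∀ x, φ (algebraMap (Base k n F) (ZField k n F) x) =
      ψ (algebraMap (Base k n F) (ZField k n F) x)) : φ = ψ :=
  IsLocalization.ringHom_ext (nonZeroDivisors (Base k n F)) (RingHom.ext h)

lemma map_id : map k n (RingHom.id F) = RingHom.id (ZField k n F) := by
  refine hom_ext k n fun x => ?_
  rw [map_algebraMap, Base.map_id]
  rfl

lemma map_comp (g : F →+* F') (g' : F' →+* F'') :
    (map k n g').comp (map k n g) = map k n (g'.comp g) := by
  refine hom_ext k n fun x => ?_
  rw [RingHom.comp_apply, map_algebraMap, map_algebraMap, map_algebraMap, Base.map_map]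

end maps

section alg

variable {Fq F F' : Type*} [Field Fq] [Field F] [Field F'] [Algebra Fq F] [Algebra Fq F']

/-- For an extension of fields `F / 𝔽_q`, the field `F{Z}` is an extension of `𝔽_q{Z}`. -/
instance (priority := low) instAlgebra : Algebra (ZField k n Fq) (ZField k n F) :=
  (map k n (algebraMap Fq F)).toAlgebra

/-- Coefficientwise application of an `𝔽_q`-homomorphism, as an `𝔽_q{Z}`-homomorphism. -/
def mapAlg (g : F →ₐ[Fq] F') : ZField k n F →ₐ[ZField k n Fq] ZField k n F' where
  __ := map k n (g : F →+* F')
  commutes' x := by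
    change ((map k n (g : F →+* F')).comp (map k n (algebraMap Fq F))) x =
      map k n (algebraMap Fq F') x
    rw [map_comp, AlgHom.comp_algebraMap]

lemma mapAlg_comp {F'' : Type*} [Field F''] [Algebra Fq F''] (g' : F' →ₐ[Fq] F'')
    (g : F →ₐ[Fq] F') : (mapAlg k n g').comp (mapAlg k n g) = mapAlg k n (g'.comp g) := by
  ext x
  exact congrFun (congrArg DFunLike.coe (map_comp k n (g : F →+* F') (g' : F' →+* F''))) x

lemma mapAlg_id : mapAlg k n (AlgHom.id Fq F) = AlgHom.id (ZField k n Fq) (ZField k n F) := by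
  ext x
  exact congrFun (congrArg DFunLike.coe (map_id k n (F := F))) x

/-- Coefficientwise application of an `𝔽_q`-automorphism. -/
def mapAlgEquiv (g : F ≃ₐ[Fq] F) : ZField k n F ≃ₐ[ZField k n Fq] ZField k n F :=
  AlgEquiv.ofAlgHom (mapAlg k n g.toAlgHom) (mapAlg k n g.symm.toAlgHom)
    (by rw [mapAlg_comp, ← mapAlg_id]; congr 1; ext x; simp)
    (by rw [mapAlg_comp, ← mapAlg_id]; congr 1; ext x; simp)

end alg

end ZField

/-! ### Twisted polynomials -/

section twisted

variable {K H H' : Type*} [Field K] [Field H] [Field H'] [Algebra K H] [Algebra K H']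

/-- A copy of `H` on which `Multiplicative ℕ` acts through the powers of `τ`. -/
def Twisted (_τ : H →ₐ[K] H) : Type _ := H

instance (τ : H →ₐ[K] H) : Field (Twisted τ) := inferInstanceAs (Field H)
instance (τ : H →ₐ[K] H) : Algebra K (Twisted τ) := inferInstanceAs (Algebra K H)

/-- The identity `H = Twisted τ`. -/
def toTw (τ : H →ₐ[K] H) : H ≃ₐ[K] Twisted τ := (AlgEquiv.refl : H ≃ₐ[K] H)

instance (τ : H →ₐ[K] H) : MulSemiringAction (Multiplicative ℕ) (Twisted τ) where
  smul m x := toTw τ ((τ ^ m.toAdd) ((toTw τ).symm x))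
  one_smul x := rfl
  mul_smul m m' x := by
    change (τ ^ (m.toAdd + m'.toAdd)) x = (τ ^ m.toAdd) ((τ ^ m'.toAdd) x)
    rw [pow_add]; rfl
  smul_zero m := map_zero (τ ^ m.toAdd)
  smul_add m := map_add (τ ^ m.toAdd)
  smul_one m := map_one (τ ^ m.toAdd)
  smul_mul m := map_mul (τ ^ m.toAdd)

lemma smul_tw (τ : H →ₐ[K] H) (m : Multiplicative ℕ) (x : Twisted τ) :
    m • x = toTw τ ((τ ^ m.toAdd) ((toTw τ).symm x)) := rfl

instance (τ : H →ₐ[K] H) : SMulCommClass (Multiplicative ℕ) K (Twisted τ) where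
  smul_comm m c x := map_smul (τ ^ m.toAdd) c x

/-- The ring `H[τ]` of twisted polynomials, with `τ c = τ(c) τ` for `c ∈ H`. -/
abbrev TwPoly (τ : H →ₐ[K] H) : Type _ := SkewPolynomial (Twisted τ)

/-- The degree in `τ` of a twisted polynomial (`0` for the zero polynomial). -/
def tdeg {τ : H →ₐ[K] H} (p : TwPoly τ) : ℕ := p.support.sup id

/-- The powers of `τ` as `K`-linear maps. -/
def powLin (τ : H →ₐ[K] H) : Multiplicative ℕ →* Module.End K H where
  toFun m := (τ ^ m.toAdd).toLinearMap
  map_one' := rfl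
  map_mul' m m' := by
    ext x
    change (τ ^ (m.toAdd + m'.toAdd)) x = (τ ^ m.toAdd) ((τ ^ m'.toAdd) x)
    rw [pow_add]; rfl

/-- Evaluation `(∑ b_i τ^i)(x) = ∑ b_i τ^i(x)`. -/
def ev (τ : H →ₐ[K] H) : TwPoly τ →ₐ[K] Module.End K H :=
  SkewMonoidAlgebra.liftNCAlgHom ((Algebra.lmul K H).comp (toTw τ).symm.toAlgHom)
    (powLin τ)
    (by
      intro x m
      ext z
      exact (map_mul (τ ^ m.toAdd) _ z).symm)

lemma ev_monomial (τ : H →ₐ[K] H) (i : ℕ) (b : Twisted τ) (x : H) :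
    ev τ (SkewPolynomial.monomial i b) x = (toTw τ).symm b * (τ ^ i) x := by
  have h : ev τ (SkewPolynomial.monomial i b) =
      (Algebra.lmul K H) ((toTw τ).symm b) * (τ ^ i).toLinearMap :=
    SkewMonoidAlgebra.liftNC_single _ _ _ _
  rw [h]
  rfl

/-- Evaluation of a square matrix over `H[τ]` on a column vector. -/
def matEv (τ : H →ₐ[K] H) (l : ℕ) :
    Matrix (Fin l) (Fin l) (TwPoly τ) →ₐ[K] Module.End K (Fin l → H) where
  toFun B :=
    { toFun x i := ∑ j, ev τ (B i j) (x j)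
      map_add' x y := by ext i; simp [Finset.sum_add_distrib]
      map_smul' c x := by ext i; simp [Finset.smul_sum] }
  map_one' := by
    refine LinearMap.ext fun x => funext fun i => ?_
    simp [Matrix.one_apply, apply_ite, ite_apply]
  map_mul' B C := by
    refine LinearMap.ext fun x => funext fun i => ?_
    simp only [Matrix.mul_apply, map_sum, map_mul, LinearMap.coe_mk, AddHom.coe_mk,
      LinearMap.sum_apply, Module.End.mul_apply]
    exact Finset.sum_comm
  map_zero' := by
    refine LinearMap.ext fun x => funext fun i => ?_
    simp
  map_add' B C := by
    refine LinearMap.ext fun x => funext fun i => ?_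
    simp [Finset.sum_add_distrib]
  commutes' c := by
    refine LinearMap.ext fun x => funext fun i => ?_
    have h : ev τ (algebraMap K (TwPoly τ) c) (x i) = c • x i := by
      rw [AlgHom.commutes]; rfl
    simpa [Matrix.algebraMap_matrix_apply, apply_ite, ite_apply] using h

lemma matEv_apply (τ : H →ₐ[K] H) {l : ℕ} (B : Matrix (Fin l) (Fin l) (TwPoly τ))
    (x : Fin l → H) (i : Fin l) : matEv τ l B x i = ∑ j, ev τ (B i j) (x j) := rfl

/-- Constants in `H[τ]`. -/
def TwPoly.C (τ : H →ₐ[K] H) : H →ₐ[K] TwPoly τ where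
  __ := (SkewPolynomial.CRingHom (R := Twisted τ)).comp (toTw τ).toAlgHom.toRingHom
  commutes' _ := rfl

/-- Extension of coefficients `H[τ] → H'[τ']` along `g : H → H'` with `g τ = τ' g`. -/
def TwPoly.map {τ : H →ₐ[K] H} {τ' : H' →ₐ[K] H'} (g : H →ₐ[K] H')
    (hg : ∀ x, g (τ x) = τ' (g x)) : TwPoly τ →ₐ[K] TwPoly τ' :=
  SkewMonoidAlgebra.liftNCAlgHom ((TwPoly.C τ').comp (g.comp (toTw τ).symm.toAlgHom))
    (SkewMonoidAlgebra.of (Twisted τ') (Multiplicative ℕ))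
    (by
      intro x m
      have h : ∀ (i : ℕ) (y : H), g ((τ ^ i) y) = (τ' ^ i) (g y) := by
        intro i
        induction i with
        | zero => intro y; rfl
        | succ i ih => intro y; rw [pow_succ, pow_succ, AlgHom.mul_apply, ih, hg]; rfl
      change SkewMonoidAlgebra.single 1 _ * SkewMonoidAlgebra.single m 1 =
        SkewMonoidAlgebra.single m 1 * SkewMonoidAlgebra.single 1 _
      rw [SkewMonoidAlgebra.single_mul_single, SkewMonoidAlgebra.single_mul_single]
      rw [one_mul, mul_one, smul_one, mul_one, one_mul]
      exact congrArg _ (h m.toAdd x))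

lemma TwPoly.map_monomial {τ : H →ₐ[K] H} {τ' : H' →ₐ[K] H'} (g : H →ₐ[K] H')
    (hg : ∀ x, g (τ x) = τ' (g x)) (i : ℕ) (b : Twisted τ) :
    TwPoly.map g hg (SkewPolynomial.monomial i b) =
      SkewPolynomial.monomial i (toTw τ' (g ((toTw τ).symm b))) := by
  change SkewMonoidAlgebra.liftNC _ _ (SkewMonoidAlgebra.single _ _) = _
  rw [SkewMonoidAlgebra.liftNC_single]
  change SkewMonoidAlgebra.single 1 _ * SkewMonoidAlgebra.single _ 1 = _
  rw [SkewMonoidAlgebra.single_mul_single, smul_one, mul_one, one_mul]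
  rfl

lemma TwPoly.map_coeff {τ : H →ₐ[K] H} {τ' : H' →ₐ[K] H'} (g : H →ₐ[K] H')
    (hg : ∀ x, g (τ x) = τ' (g x)) (p : TwPoly τ) (i : ℕ) :
    (TwPoly.map g hg p).coeff i = toTw τ' (g ((toTw τ).symm (p.coeff i))) := by
  refine SkewPolynomial.induction (motive := fun p => (TwPoly.map g hg p).coeff i =
    toTw τ' (g ((toTw τ).symm (p.coeff i)))) p ?_ fun j b q _ _ ih => ?_
  · rw [map_zero, SkewPolynomial.coeff_zero, SkewPolynomial.coeff_zero, map_zero, map_zero, map_zero]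
  rw [map_add, TwPoly.map_monomial, SkewPolynomial.coeff_add, SkewPolynomial.coeff_add, ih,
    SkewPolynomial.coeff_monomial, SkewPolynomial.coeff_monomial]
  split_ifs <;> simp

lemma map_pow_comm {τ : H →ₐ[K] H} {τ' : H' →ₐ[K] H'} (g : H →ₐ[K] H')
    (hg : ∀ x, g (τ x) = τ' (g x)) (i : ℕ) (y : H) : g ((τ ^ i) y) = (τ' ^ i) (g y) := by
  induction i generalizing y with
  | zero => rfl
  | succ i ih => rw [pow_succ, pow_succ, AlgHom.mul_apply, ih, hg]; rfl

lemma ev_map_comm {τ : H →ₐ[K] H} {τ' : H' →ₐ[K] H'} (g : H →ₐ[K] H')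
    (hg : ∀ x, g (τ x) = τ' (g x)) (d : ℕ) (hd : ∀ x, (τ ^ d) x = x) (p : TwPoly τ) (x : H') :
    (τ' ^ d) (ev τ' (TwPoly.map g hg p) x) = ev τ' (TwPoly.map g hg p) ((τ' ^ d) x) := by
  refine SkewPolynomial.induction (motive := fun p => (τ' ^ d) (ev τ' (TwPoly.map g hg p) x) =
    ev τ' (TwPoly.map g hg p) ((τ' ^ d) x)) p ?_ fun i b q _ _ ih => ?_
  · rw [map_zero, map_zero, LinearMap.zero_apply, LinearMap.zero_apply, map_zero]
  rw [map_add, map_add, LinearMap.add_apply, LinearMap.add_apply, map_add, ih,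
    TwPoly.map_monomial, ev_monomial, ev_monomial, map_mul]
  congr 2
  · rw [AlgEquiv.symm_apply_apply, ← map_pow_comm g hg, hd]
  · rw [← AlgHom.mul_apply, ← AlgHom.mul_apply, ← pow_add, ← pow_add, add_comm]

/-- The Ore map `(∑ b_i τ^i)^* = ∑ τ^{-i}(b_i) σ^i` from `H[τ]` to `H[σ]`, where `σ = τ^{-1}`. -/
def star (τ : H ≃ₐ[K] H) (p : TwPoly τ.toAlgHom) : TwPoly τ.symm.toAlgHom :=
  p.sum fun i b => SkewPolynomial.monomial i
    (toTw τ.symm.toAlgHom ((τ.symm ^ i) ((toTw τ.toAlgHom).symm b)))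

/-- The Ore map on matrices, `(B^*)_{ij} = (B_{ji})^*`. -/
def matStar (τ : H ≃ₐ[K] H) {l : ℕ} (B : Matrix (Fin l) (Fin l) (TwPoly τ.toAlgHom)) :
    Matrix (Fin l) (Fin l) (TwPoly τ.symm.toAlgHom) :=
  Matrix.of fun i j => star τ (B j i)

/-- The constant term with respect to `τ`. -/
def partialMat {τ : H →ₐ[K] H} {l : ℕ} (B : Matrix (Fin l) (Fin l) (TwPoly τ)) :
    Matrix (Fin l) (Fin l) H :=
  Matrix.of fun i j => (toTw τ).symm ((B i j).coeff 0)

/-- Right multiplication by a square matrix on row vectors over `H[τ]`; it is left `H`-linear. -/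
def rightMul {τ : H →ₐ[K] H} {l : ℕ} (B : Matrix (Fin l) (Fin l) (TwPoly τ)) :
    Module.End (Twisted τ) (Fin l → TwPoly τ) where
  toFun m := Matrix.vecMul m B
  map_add' m m' := Matrix.add_vecMul B m m'
  map_smul' c m := Matrix.smul_vecMul c m B

end twisted

/-! ### Anderson modules -/

section anderson

variable {K H H' : Type*} [Field K] [Field H] [Field H'] [Algebra K H] [Algebra K H']

/-- An Anderson `t`-module of dimension `l` over `H`: a `K`-algebra homomorphism
`E : K[t] → Mat_l(H[τ])` such that `∂E_t - θ · I` is nilpotent. -/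
structure AndersonModule (τ : H →ₐ[K] H) (θ : H) (l : ℕ) where
  toAlgHom : K[X] →ₐ[K] Matrix (Fin l) (Fin l) (TwPoly τ)
  nilpotent : IsNilpotent (partialMat (toAlgHom X) - Matrix.scalar (Fin l) θ)

namespace AndersonModule

variable {τ : H →ₐ[K] H} {θ : H} {l : ℕ}

/-- The module `E(H)`: the space `H^l` on which `a ∈ K[t]` acts by `x ↦ E_a(x)`. -/
def Points (_E : AndersonModule τ θ l) : Type _ := Fin l → H

section points

variable (E : AndersonModule τ θ l)

instance : AddCommGroup E.Points := inferInstanceAs (AddCommGroup (Fin l → H))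

instance : Module K[X] E.Points :=
  Module.compHom (Fin l → H) ((matEv τ l).comp E.toAlgHom).toRingHom

lemma smul_points (a : K[X]) (x : E.Points) : a • x = matEv τ l (E.toAlgHom a) x := rfl

/-- The `t`-motive of `E`: the row vectors `Mat_{1 × l}(H[τ])`, as a module over `H[t]`, where `H`
acts by left multiplication and `t · m = m E_t`. -/
abbrev Motive : Type _ := Module.AEval' (rightMul (E.toAlgHom X))

/-- `E` is abelian of rank `r`: its `t`-motive is free of rank `r` over `H[t]`. -/
def IsAbelian (r : ℕ) : Prop :=
  Module.Free (Twisted τ)[X] E.Motive ∧ Module.Finite (Twisted τ)[X] E.Motive ∧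
    Module.finrank (Twisted τ)[X] E.Motive = r

end points

/-- Extension of the field of definition of `E` along `g : H → H'`. -/
def baseChange (E : AndersonModule τ θ l) {τ' : H' →ₐ[K] H'} (g : H →ₐ[K] H')
    (hg : ∀ x, g (τ x) = τ' (g x)) : AndersonModule τ' (g θ) l where
  toAlgHom := (TwPoly.map g hg).mapMatrix.comp E.toAlgHom
  nilpotent := by
    have h : partialMat ((TwPoly.map g hg).mapMatrix.comp E.toAlgHom X) -
        Matrix.scalar (Fin l) (g θ) =
        (g : H →+* H').mapMatrix (partialMat (E.toAlgHom X) - Matrix.scalar (Fin l) θ) := by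
      ext i j
      simp only [partialMat, AlgHom.comp_apply, AlgHom.mapMatrix_apply, Matrix.map_apply,
        Matrix.sub_apply, Matrix.of_apply, TwPoly.map_coeff, AlgEquiv.symm_apply_apply,
        RingHom.mapMatrix_apply, map_sub, Matrix.scalar_apply, Matrix.diagonal_apply,
        RingHom.coe_coe]
      split_ifs <;> simp
    rw [h]
    exact E.nilpotent.map _

/-- If `τ^d` is trivial on `H`, then `τ'^d` acts on `E(H')` by a `K[t]`-linear endomorphism. -/
def frobEnd (E : AndersonModule τ θ l) {τ' : H' →ₐ[K] H'} (g : H →ₐ[K] H')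
    (hg : ∀ x, g (τ x) = τ' (g x)) (d : ℕ) (hd : ∀ x, (τ ^ d) x = x) :
    (E.baseChange g hg).Points →ₗ[K[X]] (E.baseChange g hg).Points where
  toFun x i := (τ' ^ d) (x i)
  map_add' x y := funext fun i => map_add (τ' ^ d) (x i) (y i)
  map_smul' a x := by
    funext i
    change (τ' ^ d) (∑ j, ev τ' (TwPoly.map g hg (E.toAlgHom a i j)) (x j)) =
      ∑ j, ev τ' (TwPoly.map g hg (E.toAlgHom a i j)) ((τ' ^ d) (x j))
    rw [map_sum]
    exact Finset.sum_congr rfl fun j _ => ev_map_comm g hg d hd _ (x j)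

/-- The kernel in `H^l` of a square matrix over `H[τ]`. -/
abbrev kernel (η : Matrix (Fin l) (Fin l) (TwPoly τ)) : Submodule K (Fin l → H) :=
  LinearMap.ker (matEv τ l η)

/-- `s` is the sum of the degrees of the entries of a diagonal matrix `U η V` with `U`, `V`
invertible over `H[τ]`. -/
def IsDiagDegree (η : Matrix (Fin l) (Fin l) (TwPoly τ)) (s : ℕ) : Prop :=
  ∃ (U V : (Matrix (Fin l) (Fin l) (TwPoly τ))ˣ) (D : Fin l → TwPoly τ),
    (U : Matrix (Fin l) (Fin l) (TwPoly τ)) * η * V = Matrix.diagonal D ∧ s = ∑ i, tdeg (D i)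

end AndersonModule

namespace AndersonModule

variable {τ : H ≃ₐ[K] H} {θ : H} {l : ℕ} (E : AndersonModule τ.toAlgHom θ l)

/-- The dual `t`-motive of `E`: the row vectors `Mat_{1 × l}(H[σ])`, `σ = τ^{-1}`, as a module over
`H[t]`, where `H` acts by left multiplication and `t · n = n E_t^*`. -/
abbrev DualMotive : Type _ := Module.AEval' (rightMul (matStar τ (E.toAlgHom X)))

/-- `E` is `K[t]`-finite of rank `r`: its dual `t`-motive is free of rank `r` over `H[t]`. -/
def IsTFinite (r : ℕ) : Prop :=
  Module.Free (Twisted τ.symm.toAlgHom)[X] E.DualMotive ∧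
    Module.Finite (Twisted τ.symm.toAlgHom)[X] E.DualMotive ∧
    Module.finrank (Twisted τ.symm.toAlgHom)[X] E.DualMotive = r

/-- The `a`-torsion modules `E[a]` and `E^*[a]` in `H^l` both have full dimension over `K`. -/
def TorsionFull (a : K[X]) : Prop :=
  ∃ s : ℕ, IsDiagDegree (E.toAlgHom a) s ∧
    Module.rank K (kernel (E.toAlgHom a)) = s ∧
    Module.rank K (kernel (matStar τ (E.toAlgHom a))) = s

end AndersonModule

end anderson

/-! ### Tate modules -/

section tate

variable {R : Type*} [CommRing R] (p : R) (V W : Type*) [AddCommGroup V] [Module R V]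
  [AddCommGroup W] [Module R W]

/-- The Tate module `lim V[p^m]`, with transition maps `x ↦ p x`. -/
def TateModule : Submodule R (ℕ → V) where
  carrier := {x | ∀ m, p ^ m • x m = 0 ∧ p • x (m + 1) = x m}
  add_mem' {x y} hx hy m := by
    simp [smul_add, (hx m).1, (hx m).2, (hy m).1, (hy m).2]
  zero_mem' m := by simp
  smul_mem' c x hx m := by
    constructor
    · rw [Pi.smul_apply, smul_comm, (hx m).1, smul_zero]
    · rw [Pi.smul_apply, smul_comm, (hx m).2, Pi.smul_apply]

/-- The `p`-adic completion `lim R / p^m R`. -/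
abbrev Compl : Type _ := AdicCompletion (Ideal.span {p}) R

variable {p}

/-- A representative in `R` of the image of `a` in `R / p^m R`. -/
def rep (a : Compl p) (m : ℕ) : R := (AdicCompletion.evalₐ (Ideal.span {p}) m a).out

lemma rep_spec (a : Compl p) (m : ℕ) :
    Ideal.Quotient.mk (Ideal.span {p} ^ m) (rep a m) = AdicCompletion.evalₐ (Ideal.span {p}) m a :=
  Quotient.out_eq _

lemma mk_rep_succ (a : Compl p) (m : ℕ) :
    Ideal.Quotient.mk (Ideal.span {p} ^ m) (rep a (m + 1)) =
      AdicCompletion.evalₐ (Ideal.span {p}) m a := by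
  have h := rep_spec a (m + 1)
  induction a using AdicCompletion.induction_on with
  | h c =>
    rw [AdicCompletion.evalₐ_mk] at h ⊢
    have h2 := congrArg (Ideal.Quotient.factor (Ideal.pow_le_pow_right (Nat.le_succ m))) h
    rw [Ideal.Quotient.factor_mk, Ideal.Quotient.factor_mk] at h2
    exact h2.trans (AdicCompletion.Ideal.mk_eq_mk (Ideal.span {p}) (Nat.le_succ m) c)

variable {V W}

lemma smul_eq_of_mk_eq {m : ℕ} {v : V} (hv : p ^ m • v = 0) {r r' : R}
    (h : Ideal.Quotient.mk (Ideal.span {p} ^ m) r = Ideal.Quotient.mk (Ideal.span {p} ^ m) r') :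
    r • v = r' • v := by
  rw [Ideal.Quotient.eq, Ideal.span_singleton_pow, Ideal.mem_span_singleton] at h
  obtain ⟨c, hc⟩ := h
  rw [← sub_eq_zero, ← sub_smul, hc, mul_comm, mul_smul, hv, smul_zero]

lemma rep_smul {a : Compl p} {m : ℕ} {v : V} (hv : p ^ m • v = 0) {r : R}
    (h : Ideal.Quotient.mk (Ideal.span {p} ^ m) r = AdicCompletion.evalₐ (Ideal.span {p}) m a) :
    rep a m • v = r • v :=
  smul_eq_of_mk_eq hv ((rep_spec a m).trans h.symm)

/-- `lim R / p^m R` acts on the Tate module componentwise. -/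
instance : SMul (Compl p) (TateModule p V) where
  smul a x := ⟨fun m => rep a m • x.1 m, fun m => by
    constructor
    · rw [smul_comm, (x.2 m).1, smul_zero]
    · change p • (rep a (m + 1) • x.1 (m + 1)) = rep a m • x.1 m
      rw [smul_comm, (x.2 m).2]
      exact (rep_smul (x.2 m).1 (mk_rep_succ a m)).symm⟩

lemma smul_tate_apply (a : Compl p) (x : TateModule p V) (m : ℕ) :
    (a • x).1 m = rep a m • x.1 m := rfl

instance : Module (Compl p) (TateModule p V) where
  one_smul x := Subtype.ext <| funext fun m => by
    rw [smul_tate_apply, rep_smul (x.2 m).1 (r := 1) (by simp), one_smul]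
  mul_smul a b x := Subtype.ext <| funext fun m => by
    rw [smul_tate_apply, smul_tate_apply, smul_tate_apply, ← mul_smul]
    exact rep_smul (x.2 m).1 (by rw [map_mul, map_mul, rep_spec, rep_spec])
  smul_zero a := Subtype.ext <| funext fun m => smul_zero (rep a m)
  smul_add a x y := Subtype.ext <| funext fun m => smul_add (rep a m) (x.1 m) (y.1 m)
  add_smul a b x := Subtype.ext <| funext fun m => by
    change rep (a + b) m • x.1 m = rep a m • x.1 m + rep b m • x.1 m
    rw [← add_smul]
    exact rep_smul (x.2 m).1 (by rw [map_add, map_add, rep_spec, rep_spec])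
  zero_smul x := Subtype.ext <| funext fun m => by
    change rep 0 m • x.1 m = 0
    rw [rep_smul (x.2 m).1 (r := 0) (by simp), zero_smul]

/-- The map of Tate modules induced by an `R`-linear map. -/
def TateModule.map (φ : V →ₗ[R] W) : TateModule p V →ₗ[Compl p] TateModule p W where
  toFun x := ⟨fun m => φ (x.1 m), fun m => by
    rw [← map_smul, ← map_smul, (x.2 m).1, (x.2 m).2, map_zero]; exact ⟨rfl, rfl⟩⟩
  map_add' x y := Subtype.ext <| funext fun m => map_add φ (x.1 m) (y.1 m)
  map_smul' a x := Subtype.ext <| funext fun m => map_smul φ (rep a m) (x.1 m)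

end tate

/-! ### Orders of finite modules -/

/-- `P` is the order of the `F[t]`-module `M`: there are monic `f_1, …, f_s` such that
`M ≅ F[t]/(f_1) ⊕ ⋯ ⊕ F[t]/(f_s)` and `P = f_1 ⋯ f_s`. -/
def IsOrder {F : Type*} [Field F] (M : Type*) [AddCommGroup M] [Module F[X] M] (P : F[X]) : Prop :=
  ∃ (s : ℕ) (f : Fin s → F[X]), (∀ i, (f i).Monic) ∧
    Nonempty (M ≃ₗ[F[X]] (∀ i, F[X] ⧸ Ideal.span {f i})) ∧ P = ∏ i, f i

/-! ### Finite characteristic -/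

section finchar

variable {Fq : Type*} [Field Fq] [Fintype Fq] (f : Fq[X]) [Fact (Irreducible f)] (k : Kind) (n : ℕ)

/-- The residue field `𝔽_f = 𝔽_q[θ]/(f)`. -/
abbrev Ff : Type _ := AdjoinRoot f

/-- An algebraic closure of `𝔽_f`. -/
abbrev Fbar : Type _ := AlgebraicClosure (Ff f)

instance : Module.Finite Fq (Ff f) :=
  (AdjoinRoot.powerBasis (Fact.out (p := Irreducible f)).ne_zero).finite

instance : Algebra.IsAlgebraic Fq (Fbar f) :=
  Algebra.IsAlgebraic.trans Fq (Ff f) (Fbar f)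

/-- The endomorphism `τ` of `𝔽_f{Z}`: the `q`-th power map on the coefficients. -/
def tauf : ZField k n (Ff f) →ₐ[ZField k n Fq] ZField k n (Ff f) :=
  ZField.mapAlg k n (FiniteField.frobeniusAlgHom Fq (Ff f))

/-- The automorphism `τ` of `𝔽̄_f{Z}`: the `q`-th power map on the coefficients. -/
def taubar : ZField k n (Fbar f) ≃ₐ[ZField k n Fq] ZField k n (Fbar f) :=
  ZField.mapAlgEquiv k n (FiniteField.frobeniusAlgEquivOfAlgebraic Fq (Fbar f))

/-- `λ`, viewed as an element of `𝔽_q{Z}[t]`. -/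
abbrev constPoly (lam : Fq[X]) : (ZField k n Fq)[X] := lam.map (ZField.const k n Fq)

/-- The inclusion `𝔽_f{Z} ⊆ 𝔽̄_f{Z}`. -/
def incl : ZField k n (Ff f) →ₐ[ZField k n Fq] ZField k n (Fbar f) :=
  ZField.mapAlg k n (IsScalarTower.toAlgHom Fq (Ff f) (Fbar f))

lemma incl_tauf (x : ZField k n (Ff f)) :
    incl f k n (tauf f k n x) = (taubar f k n).toAlgHom (incl f k n x) := by
  have h : (IsScalarTower.toAlgHom Fq (Ff f) (Fbar f)).comp
      (FiniteField.frobeniusAlgHom Fq (Ff f)) =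
      (FiniteField.frobeniusAlgEquivOfAlgebraic Fq (Fbar f)).toAlgHom.comp
        (IsScalarTower.toAlgHom Fq (Ff f) (Fbar f)) := by
    ext
    simp
  have h2 := congrArg (ZField.mapAlg k n) h
  rw [← ZField.mapAlg_comp, ← ZField.mapAlg_comp] at h2
  exact congrFun (congrArg DFunLike.coe h2) x

lemma tauf_pow (x : ZField k n (Ff f)) : (tauf f k n ^ f.natDegree) x = x := by
  have h : ∀ i : ℕ, tauf f k n ^ i =
      ZField.mapAlg k n (FiniteField.frobeniusAlgHom Fq (Ff f) ^ i) := by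
    intro i
    induction i with
    | zero => exact (ZField.mapAlg_id k n).symm
    | succ i ih => rw [pow_succ, pow_succ, ih]; exact ZField.mapAlg_comp k n _ _
  have : Finite (Ff f) := Module.finite_of_finite Fq
  have h2 : FiniteField.frobeniusAlgHom Fq (Ff f) ^ f.natDegree = 1 := by
    have h3 := FiniteField.orderOf_frobeniusAlgHom Fq (Ff f)
    rw [PowerBasis.finrank (AdjoinRoot.powerBasis (Fact.out (p := Irreducible f)).ne_zero),
      AdjoinRoot.powerBasis_dim] at h3
    rw [← h3]
    exact pow_orderOf_eq_one _
  rw [h, h2]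
  exact congrFun (congrArg DFunLike.coe (ZField.mapAlg_id k n (Fq := Fq) (F := Ff f))) x

variable {f k n} {θ : ZField k n (Ff f)} {l : ℕ}

/-- An Anderson `t`-module over `𝔽_f{Z}`, regarded as a `t`-module over `𝔽̄_f{Z}`. -/
abbrev AndersonModule.bar (E : AndersonModule (tauf f k n) θ l) :
    AndersonModule (taubar f k n).toAlgHom (incl f k n θ) l :=
  E.baseChange (incl f k n) (incl_tauf f k n)

/-- The endomorphism `τ^d` of `E(𝔽̄_f{Z})`, where `d = deg f`. -/
abbrev AndersonModule.tauPow (E : AndersonModule (tauf f k n) θ l) :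
    E.bar.Points →ₗ[(ZField k n Fq)[X]] E.bar.Points :=
  E.frobEnd (incl f k n) (incl_tauf f k n) f.natDegree (tauf_pow f k n)

end finchar

end AndersonT

end

/-! Write `K` for 𝔽_q{Z}, `H` for the same field over the algebraic closure, and `N` for the dual
t-motive, on which left multiplication by σ is semilinear. The map ∑ a_i σ^i ↦ ∑ τ^i(a_i) makes E(H)
the cokernel of the injective map σ - 1 on `N` (`AndersonModule.presentation`). Let Φ be right
multiplication by σ^d. It is H[t]-linear because E_t has coefficients fixed by τ^d, and it induces
τ^d on E(H). Both sides of the formula are read off from the single polynomial det(1 - Φ | N) in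
H[t].

The bridge is a snake lemma. If `g` is an injective H[t]-linear endomorphism of `N` commuting with
σ, the kernel of the corresponding map on E(H) embeds in the σ-fixed vectors of N/gN
(`exists_snake_map`). Since `K` is the fixed field of σ, fixed vectors independent over `K` stay
independent over `H` (`linearIndependent_of_fixed`). So as soon as the kernel is large enough over
`K`, N/gN is its extension of scalars to `H`, compatibly with t and Φ. This is applied to two maps.

For g = λ^m, freeness of `N` gives N/gN the dimension r·m·deg λ. Full dimension, together with
freeness of the t-motive, gives E[λ^m] the same dimension over `K`. Hence the Tate module is free of
rank r, and det(1 - Φ) is congruent modulo λ^m to det(1 - τ^d) on it (`dvd_det_sub_det_tate`). A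
polynomial over `H` congruent to polynomials over `K` modulo every λ^m has its coefficients in `K`
(`exists_map_eq_of_dvd_sub`), so the value of the characteristic polynomial at 1 is det(1 - Φ), an
element of K[t].

For g = 1 - Φ, the cokernel has dimension l·d over `H`, and the points over 𝔽_f{Z} are fixed by τ^d
and contain l·d independent vectors. So t has the same characteristic polynomial on these points and
on N/(1 - Φ)N. On the points it is the order (`isOrder_charpoly`); on N/(1 - Φ)N it is det(1 - Φ) up
to a unit, by Smith normal form (`associated_det_charpoly`). -/

noncomputable section

namespace AndersonT

/-! ### Modules over `F[X]`: orders, characteristic polynomials and determinants. -/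

section polymod

variable (F : Type*) [Field F] (V W : Type*) [AddCommGroup V] [Module F V] [Module F[X] V]
  [IsScalarTower F F[X] V] [AddCommGroup W] [Module F W] [Module F[X] W] [IsScalarTower F F[X] W]

/-- Multiplication by `X` on an `F[X]`-module, as an `F`-linear map. -/
def mulX : Module.End F V := Algebra.lsmul F F V (X : F[X])

variable {V W}

lemma mulX_apply (v : V) : mulX F V v = (X : F[X]) • v := rfl

lemma charpoly_mulX_congr [Module.Finite F V] [Module.Finite F W] (e : V ≃ₗ[F[X]] W) :
    (mulX F V).charpoly = (mulX F W).charpoly := by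
  rw [← LinearEquiv.charpoly_conj (e.restrictScalars F) (mulX F V)]
  congr 1
  ext w
  simp [mulX_apply, LinearEquiv.conj_apply]

variable {F}

lemma finite_quotient_span {f : F[X]} (hf : f ≠ 0) : Module.Finite F (F[X] ⧸ Ideal.span {f}) :=
  (AdjoinRoot.powerBasis hf).finite

lemma charpoly_mulX_smul [Module.Finite F V] (v : V) : (mulX F V).charpoly • v = 0 := by
  have h := congrArg (fun φ : Module.End F V => φ v) (LinearMap.aeval_self_charpoly (mulX F V))
  rw [show mulX F V = Algebra.lsmul F F V (X : F[X]) from rfl, Polynomial.aeval_algHom_apply,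
    Polynomial.aeval_X_left_apply] at h
  exact h

/-- Cayley–Hamilton applied to the class of `1` shows that `f` divides the characteristic
polynomial; both are monic of the same degree. -/
lemma charpoly_mulX_quotient {f : F[X]} (hf : f.Monic) [Module.Finite F (F[X] ⧸ Ideal.span {f})] :
    (mulX F (F[X] ⧸ Ideal.span {f})).charpoly = f := by
  refine (Polynomial.eq_of_monic_of_dvd_of_natDegree_le hf (LinearMap.charpoly_monic _) ?_
    ?_)
  · have h := charpoly_mulX_smul (F := F) (Ideal.Quotient.mk (Ideal.span {f}) 1)
    rw [← Ideal.mem_span_singleton, ← Ideal.Quotient.eq_zero_iff_mem, ← h]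
    generalize (mulX F (F[X] ⧸ Ideal.span {f})).charpoly = p
    conv_lhs => rw [← mul_one p]
    rfl
  · rw [LinearMap.charpoly_natDegree]
    exact finrank_quotient_span_eq_natDegree.le

lemma finite_pi_of_finite {ι : Type*} [Finite ι] (M : ι → Type*) [∀ i, AddCommGroup (M i)]
    [∀ i, Module F (M i)] [h : Module.Finite F (∀ i, M i)] (i : ι) : Module.Finite F (M i) :=
  Module.Finite.of_surjective (LinearMap.proj i : (∀ i, M i) →ₗ[F] M i)
    (Function.surjective_eval i)

lemma charpoly_mulX_pi {s : ℕ} (M : Fin s → Type*) [∀ i, AddCommGroup (M i)]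
    [∀ i, Module F (M i)] [∀ i, Module F[X] (M i)] [∀ i, IsScalarTower F F[X] (M i)]
    [∀ i, Module.Finite F (M i)] :
    (mulX F (∀ i, M i)).charpoly = ∏ i, (mulX F (M i)).charpoly := by
  induction s with
  | zero =>
    rw [Fin.prod_univ_zero]
    have := LinearMap.charpoly_natDegree (mulX F (∀ i, M i))
    rw [Module.finrank_zero_of_subsingleton] at this
    exact (LinearMap.charpoly_monic _).natDegree_eq_zero.mp this
  | succ s ih =>
    rw [Fin.prod_univ_succ, ← ih (fun i => M i.succ), ← LinearMap.charpoly_prodMap,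
      ← LinearEquiv.charpoly_conj (Fin.consLinearEquiv F M)]
    congr 1
    refine LinearMap.ext fun x => funext fun i => ?_
    refine Fin.cases ?_ (fun j => ?_) i <;> rfl

lemma ne_zero_of_finite_quotient_span {f : F[X]} [h : Module.Finite F (F[X] ⧸ Ideal.span {f})] :
    f ≠ 0 := by
  rintro rfl
  rw [Ideal.span_singleton_eq_bot.mpr rfl] at h
  have : Module.Finite F F[X] := Module.Finite.equiv
    ((Submodule.quotEquivOfEqBot (⊥ : Submodule F[X] F[X]) rfl).restrictScalars F)
  exact Polynomial.not_finite this

lemma charpoly_mulX_of_equiv_pi [Module.Finite F V] {s : ℕ} {f : Fin s → F[X]}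
    (hf : ∀ i, (f i).Monic) (e : V ≃ₗ[F[X]] ∀ i, F[X] ⧸ Ideal.span {f i}) :
    (mulX F V).charpoly = ∏ i, f i := by
  have := fun i => finite_quotient_span (hf i).ne_zero
  rw [charpoly_mulX_congr F e, charpoly_mulX_pi]
  exact Finset.prod_congr rfl fun i _ => charpoly_mulX_quotient (hf i)

lemma associated_monic {f : F[X]} (hf : f ≠ 0) : Associated (f * C f.leadingCoeff⁻¹) f :=
  (associated_mul_unit_left f _ (isUnit_C.mpr
    (isUnit_iff_ne_zero.mpr (inv_ne_zero (leadingCoeff_ne_zero.mpr hf)))))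

/-- For `V ≅ ∏ F[X]/(f_i)`, the `f_i` may be taken monic. -/
lemma charpoly_mulX_of_equiv_pi' [Module.Finite F V] {ι : Type*} [Fintype ι] {f : ι → F[X]}
    (e : V ≃ₗ[F[X]] ∀ i, F[X] ⧸ Ideal.span {f i}) :
    Associated (mulX F V).charpoly (∏ i, f i) ∧ IsOrder V (mulX F V).charpoly := by
  classical
  have hfin : Module.Finite F (∀ i, F[X] ⧸ Ideal.span {f i}) :=
    Module.Finite.equiv (e.restrictScalars F)
  have hne : ∀ i, f i ≠ 0 := fun i =>
    have := finite_pi_of_finite (F := F) (fun i => F[X] ⧸ Ideal.span {f i}) i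
    ne_zero_of_finite_quotient_span
  let σ := (Fintype.equivFin ι).symm
  let g : Fin (Fintype.card ι) → F[X] := fun i => f (σ i) * C (f (σ i)).leadingCoeff⁻¹
  have hg : ∀ i, (g i).Monic := fun i => Polynomial.monic_mul_leadingCoeff_inv (hne _)
  let e2 : V ≃ₗ[F[X]] ∀ i, F[X] ⧸ Ideal.span {g i} :=
    (e.trans (LinearEquiv.piCongrLeft' F[X] (fun i => F[X] ⧸ Ideal.span {f i}) σ.symm)).trans
      (LinearEquiv.piCongrRight fun i =>
        Submodule.quotEquivOfEq _ _ (Ideal.span_singleton_eq_span_singleton.mpr (associated_monic (hne _))).symm)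
  have h := charpoly_mulX_of_equiv_pi hg e2
  refine ⟨?_, ⟨_, g, hg, ⟨e2⟩, h⟩⟩
  rw [h, ← Equiv.prod_comp σ f]
  exact Associated.prod _ _ _ fun i _ => associated_monic (hne _)

/-- By Cayley–Hamilton `V` is torsion, so the structure theorem splits it into cyclic modules, on
each of which the characteristic polynomial of `X` is the monic generator. -/
lemma isOrder_charpoly [Module.Finite F V] : IsOrder V (mulX F V).charpoly := by
  classical
  have : Module.Finite F[X] V := Module.Finite.of_restrictScalars_finite F F[X] V
  have ht : Module.IsTorsion F[X] V := by
    intro v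
    refine ⟨⟨(mulX F V).charpoly, mem_nonZeroDivisors_of_ne_zero
      (LinearMap.charpoly_monic _).ne_zero⟩, ?_⟩
    exact charpoly_mulX_smul v
  obtain ⟨ι, _, p, _, e, ⟨φ⟩⟩ := Module.equiv_directSum_of_isTorsion ht
  exact (charpoly_mulX_of_equiv_pi' (f := fun i => p i ^ e i)
    (φ.trans (DirectSum.linearEquivFunOnFintype F[X] ι _))).2

variable {N : Type*} [AddCommGroup N] [Module F[X] N]

lemma finrank_range_of_injective [Module.Free F[X] N] [Module.Finite F[X] N]
    {g : N →ₗ[F[X]] N} (hg : Function.Injective g) :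
    Module.finrank F[X] (LinearMap.range g) = Module.finrank F[X] N :=
  (LinearEquiv.ofInjective g hg).finrank_eq.symm

lemma lsmul_injective_of_ne_zero [Module.Free F[X] N] {p : F[X]} (hp : p ≠ 0) :
    Function.Injective (LinearMap.lsmul F[X] N p) :=
  LinearMap.lsmul_injective hp

variable [Module F N] [IsScalarTower F F[X] N]

/-- The image has full rank, so by Smith normal form the cokernel is a finite product of quotients
`F[X]/(a_i)` with all `a_i` nonzero. -/
lemma finite_quotient_range [Module.Free F[X] N] [Module.Finite F[X] N]
    {g : N →ₗ[F[X]] N} (hg : Function.Injective g) :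
    Module.Finite F (N ⧸ LinearMap.range g) := by
  let b := Module.Free.chooseBasis F[X] N
  have := fun i => finite_quotient_span (F := F) (Submodule.smithNormalFormCoeffs_ne_zero b
    (finrank_range_of_injective hg) i)
  exact Module.Finite.equiv ((Submodule.quotientEquivPiSpan _ b
    (finrank_range_of_injective hg)).restrictScalars F).symm

/-- The determinant of an endomorphism of a free `F[X]`-module is the characteristic polynomial
of `X` on the cokernel, up to a unit. -/
lemma associated_det_charpoly [Module.Free F[X] N] [Module.Finite F[X] N] {g : N →ₗ[F[X]] N}
    (hg : Function.Injective g) [Module.Finite F (N ⧸ LinearMap.range g)] :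
    Associated (LinearMap.det g) (mulX F (N ⧸ LinearMap.range g)).charpoly := by
  classical
  let b := Module.Free.chooseBasis F[X] N
  have hr := finrank_range_of_injective hg
  refine Associated.trans ?_ (charpoly_mulX_of_equiv_pi' (F := F)
    (Submodule.quotientEquivPiSpan _ b hr)).1.symm
  let b' := Submodule.smithNormalFormTopBasis b hr
  rw [← Matrix.det_diagonal, ← LinearMap.det_toLin b']
  -- `e` sends `b' i` to the `g`-preimage of the `i`-th Smith basis vector of the range. So `g ∘ e`
  -- is diagonal in `b'`, and composing with the automorphism `e` changes the determinant only by a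
  -- unit.
  let e : N ≃ₗ[F[X]] N := (b'.equiv (Submodule.smithNormalFormBotBasis b hr) (Equiv.refl _)).trans
    (LinearEquiv.ofInjective g hg).symm
  refine (LinearMap.associated_det_of_eq_comp e _ _ fun x => ?_).symm
  have h : ∀ y : LinearMap.range g, g ((LinearEquiv.ofInjective g hg).symm y) = y := fun y => by
    conv_rhs => rw [← (LinearEquiv.ofInjective g hg).apply_symm_apply y]
    rfl
  have h2 : g ∘ₗ (e : N →ₗ[F[X]] N) =
      Matrix.toLin b' b' (Matrix.diagonal (Submodule.smithNormalFormCoeffs b hr)) := by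
    refine b'.ext fun i => ?_
    rw [LinearMap.comp_apply, LinearEquiv.coe_coe, LinearEquiv.trans_apply, h, b'.equiv_apply,
      Matrix.toLin_self]
    simp [Matrix.diagonal_apply, b']
  exact (LinearMap.congr_fun h2 x).symm

/-- Multiplication by `p` has determinant `p ^ rank`, and the degree of the determinant is the
dimension of the cokernel. -/
lemma finrank_quotient_lsmul [Module.Free F[X] N] [Module.Finite F[X] N] {p : F[X]} (hp : p ≠ 0) :
    Module.finrank F (N ⧸ LinearMap.range (LinearMap.lsmul F[X] N p)) =
      Module.finrank F[X] N * p.natDegree := by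
  have hg := lsmul_injective_of_ne_zero (N := N) hp
  have := finite_quotient_range hg
  have h := associated_det_charpoly hg
  rw [← LinearMap.charpoly_natDegree (mulX F (N ⧸ LinearMap.range (LinearMap.lsmul F[X] N p))),
    ← Polynomial.natDegree_eq_of_degree_eq (Polynomial.degree_eq_degree_of_associated h),
    show LinearMap.lsmul F[X] N p = p • LinearMap.id from rfl, LinearMap.det_smul,
    LinearMap.det_id, mul_one, Polynomial.natDegree_pow]

end polymod

/-! ### Fixed vectors of semilinear maps and the snake relation. -/

section semilinear

variable {K H : Type*} [Field K] [Field H] [Algebra K H] {σ : H →+* H}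

/-- Artin's lemma: if `K` is the fixed field of `σ`, then vectors which are fixed by a `σ`-semilinear
map and linearly independent over `K` are linearly independent over `H`. -/
lemma linearIndependent_of_fixed (hσ : ∀ c : H, σ c = c → ∃ k : K, algebraMap K H k = c)
    {V U : Type*} [AddCommGroup V] [Module H V] [AddCommGroup U] [Module K U]
    (S : V →ₛₗ[σ] V) (j : U →ₛₗ[algebraMap K H] V) (hj : Function.Injective j)
    (hS : ∀ x, S (j x) = j x) {ι : Type*} {v : ι → U} (hv : LinearIndependent K v) :
    LinearIndependent H (fun i => j (v i)) := by
  classical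
  rw [linearIndependent_iff']
  intro s
  induction s using Finset.induction_on with
  | empty => simp
  | insert a s ha ih =>
    intro c hc
    have key : c a = 0 := by
      by_contra hne
      -- After normalising the coefficient at `a` to `1`, the relation minus its image under `S` no
      -- longer involves `a`. By induction all `c' i` are then fixed by `σ`, so they come from `K`
      -- and the relation pulls back to `v`.
      let c' : ι → H := fun i => (c a)⁻¹ * c i
      have hc'a : c' a = 1 := inv_mul_cancel₀ hne
      have h1 : ∑ i ∈ insert a s, c' i • j (v i) = 0 := by
        simp only [c', mul_smul, ← Finset.smul_sum, hc, smul_zero]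
      have h2 : ∑ i ∈ insert a s, σ (c' i) • j (v i) = 0 := by
        have := congrArg S h1
        simpa only [map_sum, LinearMap.map_smulₛₗ, hS, map_zero] using this
      have h3 : ∑ i ∈ s, (σ (c' i) - c' i) • j (v i) = 0 := by
        have : ∑ i ∈ insert a s, (σ (c' i) - c' i) • j (v i) = 0 := by
          simp only [sub_smul, Finset.sum_sub_distrib, h1, h2, sub_zero]
        rwa [Finset.sum_insert ha, hc'a, map_one, sub_self, zero_smul, zero_add] at this
      have h4 : ∀ i ∈ insert a s, σ (c' i) = c' i := by
        intro i hi
        rcases Finset.mem_insert.mp hi with rfl | hi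
        · rw [hc'a, map_one]
        · exact sub_eq_zero.mp (ih _ h3 i hi)
      have h5 : ∀ i, ∃ k : K, i ∈ insert a s → algebraMap K H k = c' i := fun i => by
        by_cases hi : i ∈ insert a s
        · obtain ⟨k, hk⟩ := hσ _ (h4 i hi)
          exact ⟨k, fun _ => hk⟩
        · exact ⟨0, fun h => absurd h hi⟩
      choose k hk using h5
      have h6 : ∑ i ∈ insert a s, k i • v i = 0 := by
        apply hj
        rw [map_zero, map_sum, ← h1]
        exact Finset.sum_congr rfl fun i hi => by rw [LinearMap.map_smulₛₗ, hk i hi]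
      have h7 := linearIndependent_iff'.mp hv _ _ h6 a (Finset.mem_insert_self a s)
      have h8 := hk a (Finset.mem_insert_self a s)
      rw [h7, map_zero, hc'a] at h8
      exact zero_ne_one h8
    rw [Finset.sum_insert ha, key, zero_smul, zero_add] at hc
    intro i hi
    rcases Finset.mem_insert.mp hi with rfl | hi
    · exact key
    · exact ih _ hc i hi

variable (σ) (N E : Type*) [AddCommGroup N] [Module H[X] N] [AddCommGroup E] [Module K[X] E]

/-- A presentation `0 → N → N → E → 0` of a `K[t]`-module by an `H[t]`-module with a `σ`-semilinear
endomorphism `S`, where the first map is `S - 1`. -/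
structure SemilinearPresentation where
  S : N →ₛₗ[mapRingHom σ] N
  ε : N →+ E
  ε_smul : ∀ (p : K[X]) (n : N), ε (p.map (algebraMap K H) • n) = p • ε n
  surjective : Function.Surjective ε
  ker : ∀ n, ε n = 0 ↔ ∃ y, S y - y = n
  injective : ∀ n, S n = n → n = 0

variable {σ N E}

namespace SemilinearPresentation

variable (D : SemilinearPresentation (K := K) σ N E) {g : N →ₗ[H[X]] N}
  (hgS : ∀ n, g (D.S n) = D.S (g n))

/-- The semilinear endomorphism of the cokernel of `g`. -/
def quotS : (N ⧸ LinearMap.range g) →ₛₗ[mapRingHom σ] (N ⧸ LinearMap.range g) :=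
  Submodule.mapQ _ _ D.S (by
    rintro _ ⟨n, rfl⟩
    exact ⟨D.S n, hgS n⟩)

/-- The snake relation between the kernel of `g` on `E` and the fixed points of `S` on the cokernel
of `g` on `N`. -/
def Snake (D : SemilinearPresentation (K := K) σ N E) (g : N →ₗ[H[X]] N) (x : E)
    (w : N ⧸ LinearMap.range g) : Prop :=
  ∃ n n', D.ε n = x ∧ g n = D.S n' - n' ∧ w = Submodule.Quotient.mk n'

variable {D}

lemma Snake.add {x y : E} {w z : N ⧸ LinearMap.range g} (h : D.Snake g x w) (h' : D.Snake g y z) :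
    D.Snake g (x + y) (w + z) := by
  obtain ⟨n, n', rfl, h2, rfl⟩ := h
  obtain ⟨m, m', rfl, h4, rfl⟩ := h'
  exact ⟨n + m, n' + m', map_add _ _ _, by rw [map_add, h2, h4, map_add]; abel, rfl⟩

lemma Snake.smul (hσ : ∀ k : K, σ (algebraMap K H k) = algebraMap K H k) (p : K[X]) {x : E}
    {w : N ⧸ LinearMap.range g} (h : D.Snake g x w) :
    D.Snake g (p • x) (p.map (algebraMap K H) • w) := by
  obtain ⟨n, n', rfl, h2, rfl⟩ := h
  have hp : mapRingHom σ (p.map (algebraMap K H)) = p.map (algebraMap K H) := by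
    rw [coe_mapRingHom, Polynomial.map_map, show σ.comp (algebraMap K H) = algebraMap K H from
      RingHom.ext hσ]
  refine ⟨p.map (algebraMap K H) • n, p.map (algebraMap K H) • n', D.ε_smul _ _, ?_, rfl⟩
  rw [map_smul, h2, smul_sub, LinearMap.map_smulₛₗ, hp]

/-- One direction cancels `S - 1`, which is injective on `N`; the other cancels `g`. Both use that
the two maps commute. -/
lemma Snake.eq_zero_iff (hgS : ∀ n, g (D.S n) = D.S (g n)) (hg : Function.Injective g) {x : E}
    {w : N ⧸ LinearMap.range g} (h : D.Snake g x w) : x = 0 ↔ w = 0 := by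
  obtain ⟨n, n', rfl, h2, rfl⟩ := h
  rw [D.ker, Submodule.Quotient.mk_eq_zero]
  constructor
  · rintro ⟨y, rfl⟩
    refine ⟨y, ?_⟩
    rw [map_sub, hgS] at h2
    refine (sub_eq_zero.mp (D.injective _ ?_))
    rw [map_sub, sub_eq_sub_iff_sub_eq_sub]
    exact h2
  · rintro ⟨y, rfl⟩
    refine ⟨y, hg ?_⟩
    rw [h2, map_sub, hgS]

lemma Snake.exists {x : E} {gE : E →ₗ[K[X]] E} (hgE : ∀ n, D.ε (g n) = gE (D.ε n))
    (hx : gE x = 0) : ∃ w, D.Snake g x w := by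
  obtain ⟨n, rfl⟩ := D.surjective x
  rw [← hgE, D.ker] at hx
  obtain ⟨y, hy⟩ := hx
  exact ⟨_, n, y, rfl, hy.symm, rfl⟩

/-- `S` moves `n'` by `g n`, which vanishes in the cokernel. -/
lemma Snake.fixed {x : E} {w : N ⧸ LinearMap.range g} (h : D.Snake g x w) :
    D.quotS hgS w = w := by
  obtain ⟨n, n', rfl, h2, rfl⟩ := h
  exact (Submodule.Quotient.eq _).mpr ⟨n, h2⟩

lemma Snake.map {x : E} {w : N ⧸ LinearMap.range g} (h : D.Snake g x w) {Φ : N →ₗ[H[X]] N}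
    (hΦS : ∀ n, Φ (D.S n) = D.S (Φ n)) (hΦg : ∀ n, Φ (g n) = g (Φ n)) {ΦE : E →ₗ[K[X]] E}
    (hΦ : ∀ n, D.ε (Φ n) = ΦE (D.ε n)) :
    D.Snake g (ΦE x) (Submodule.mapQ _ _ Φ (by
      rintro _ ⟨n, rfl⟩
      exact ⟨Φ n, (hΦg n).symm⟩ : LinearMap.range g ≤ (LinearMap.range g).comap Φ) w) := by
  obtain ⟨n, n', rfl, h2, rfl⟩ := h
  exact ⟨Φ n, Φ n', hΦ n, by rw [← hΦg, h2, map_sub, hΦS], rfl⟩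

/-- The difference of the two values is related to `0`. -/
lemma Snake.unique (hσ : ∀ k : K, σ (algebraMap K H k) = algebraMap K H k)
    (hgS : ∀ n, g (D.S n) = D.S (g n)) (hg : Function.Injective g) {x : E}
    {w z : N ⧸ LinearMap.range g} (h : D.Snake g x w) (h' : D.Snake g x z) : w = z := by
  have h1 := h.add (h'.smul hσ (-1))
  rw [Polynomial.map_neg, Polynomial.map_one, neg_smul, one_smul, neg_smul, one_smul,
    add_neg_cancel, ← sub_eq_add_neg] at h1
  exact sub_eq_zero.mp ((h1.eq_zero_iff hgS hg).mp rfl)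

/-- The snake relation is the graph of an injective semilinear map from the kernel of `g` on `E`
to the cokernel of `g` on `N`. -/
lemma exists_snake_map (hσ : ∀ k : K, σ (algebraMap K H k) = algebraMap K H k)
    (hgS : ∀ n, g (D.S n) = D.S (g n)) (hg : Function.Injective g) {gE : E →ₗ[K[X]] E}
    (hgE : ∀ n, D.ε (g n) = gE (D.ε n)) :
    ∃ j : LinearMap.ker gE →ₛₗ[mapRingHom (algebraMap K H)] (N ⧸ LinearMap.range g),
      Function.Injective j ∧ ∀ x : LinearMap.ker gE, D.Snake g (x : E) (j x) := by
  choose j hj using fun x : LinearMap.ker gE => Snake.exists hgE x.2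
  let j' : LinearMap.ker gE →ₛₗ[mapRingHom (algebraMap K H)] (N ⧸ LinearMap.range g) :=
    { toFun := j
      map_add' x y := (hj _).unique hσ hgS hg ((hj x).add (hj y))
      map_smul' p x := (hj _).unique hσ hgS hg ((hj x).smul hσ p) }
  refine ⟨j', ?_, hj⟩
  rw [injective_iff_map_eq_zero]
  intro x hx
  exact Subtype.ext (((hj x).eq_zero_iff hgS hg).mpr hx)

end SemilinearPresentation

end semilinear

/-! ### Bases of Tate modules. -/

section tatefree

variable {R : Type*} [CommRing R] {p : R} {V : Type*} [AddCommGroup V] [Module R V] {r : ℕ}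

lemma tate_apply_add (x : TateModule p V) (m i : ℕ) : p ^ i • x.1 (m + i) = x.1 m := by
  induction i with
  | zero => simp
  | succ i ih => rw [pow_succ, mul_smul, ← add_assoc, (x.2 (m + i)).2, ih]

lemma tate_sum_apply {ι : Type*} (s : Finset ι) (a : ι → Compl p) (e : ι → TateModule p V) (m : ℕ) :
    (∑ i ∈ s, a i • e i).1 m = ∑ i ∈ s, rep (a i) m • (e i).1 m := by
  rw [Submodule.coe_sum, Finset.sum_apply]
  rfl

/-- Elements of the Tate module whose first components form a basis of the `p`-torsion. -/
structure IsTateBasis (e : Fin r → TateModule p V) : Prop where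
  indep : ∀ a : Fin r → R, ∑ i, a i • (e i).1 1 = 0 → ∀ i, p ∣ a i
  span : ∀ v : V, p • v = 0 → ∃ a : Fin r → R, v = ∑ i, a i • (e i).1 1

namespace IsTateBasis

variable {e : Fin r → TateModule p V} (h : IsTateBasis e)
include h

/-- Multiplying the relation by `p` lowers its level by one, so by induction `a i = p ^ m * b i`. As
`p ^ m` carries level `m + 1` to level `1`, the `b i` satisfy a relation at level `1`. -/
lemma indep_pow (m : ℕ) (a : Fin r → R) (ha : ∑ i, a i • (e i).1 m = 0) (i : Fin r) :
    p ^ m ∣ a i := by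
  induction m generalizing a i with
  | zero => simp
  | succ m ih =>
    have h1 : ∑ i, a i • (e i).1 m = 0 := by
      have := congrArg (p • ·) ha
      simpa only [Finset.smul_sum, smul_comm p, ((e _).2 m).2, smul_zero] using this
    choose b hb using fun i => ih a h1 i
    have h2 : ∑ i, b i • (e i).1 1 = 0 := by
      rw [← ha]
      refine Finset.sum_congr rfl fun i _ => ?_
      rw [hb i, mul_comm, mul_smul, add_comm m 1, tate_apply_add]
    obtain ⟨c, hc⟩ := h.indep b h2 i
    exact ⟨c, by rw [hb i, hc, pow_succ, mul_assoc]⟩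

/-- Coefficients that express `p • v` at level `m` express `v` at level `m + 1` up to an element of
the `p`-torsion, which level `1` accounts for. -/
lemma span_pow (m : ℕ) (v : V) (hv : p ^ m • v = 0) :
    ∃ a : Fin r → R, v = ∑ i, a i • (e i).1 m := by
  induction m generalizing v with
  | zero => exact ⟨0, by simpa using hv⟩
  | succ m ih =>
    obtain ⟨a, ha⟩ := ih (p • v) (by rw [← mul_smul, ← pow_succ, hv])
    obtain ⟨b, hb⟩ := h.span (v - ∑ i, a i • (e i).1 (m + 1)) (by
      rw [smul_sub, ha, Finset.smul_sum, sub_eq_zero]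
      exact Finset.sum_congr rfl fun i _ => by rw [smul_comm p, ((e i).2 m).2])
    refine ⟨fun i => a i + b i * p ^ m, ?_⟩
    rw [← sub_add_cancel v (∑ i, a i • (e i).1 (m + 1)), hb, ← Finset.sum_add_distrib]
    refine Finset.sum_congr rfl fun i _ => ?_
    rw [add_smul, mul_smul, add_comm m 1, tate_apply_add, add_comm]

/-- Coordinates at level `m` are determined modulo `p ^ m`, so those chosen at successive levels
form a Cauchy sequence, and its limit is correct at every level. -/
lemma existsUnique_coord (x : TateModule p V) :
    ∃ a : Fin r → Compl p, ∑ i, a i • e i = x := by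
  choose a ha using fun m => h.span_pow m (x.1 m) (x.2 m).1
  have h1 : ∀ m i, p ^ m ∣ a (m + 1) i - a m i := fun m i => by
    refine h.indep_pow m (fun i => a (m + 1) i - a m i) ?_ i
    simp only [sub_smul, Finset.sum_sub_distrib]
    rw [← ha m, ← (x.2 m).2, ha (m + 1), Finset.smul_sum, sub_eq_zero]
    exact Finset.sum_congr rfl fun i _ => by rw [smul_comm p, ((e i).2 m).2]
  let A : Fin r → Compl p := fun i => AdicCompletion.mk (Ideal.span {p}) R
    (AdicCompletion.AdicCauchySequence.mk (Ideal.span {p}) R (fun m => a m i) (fun m => by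
      rw [SModEq.sub_mem, smul_eq_mul, Ideal.mul_top, Ideal.span_singleton_pow,
        Ideal.mem_span_singleton, ← dvd_neg, neg_sub]
      exact h1 m i))
  refine ⟨A, Subtype.ext (funext fun m => ?_)⟩
  rw [tate_sum_apply, ha m]
  refine Finset.sum_congr rfl fun i _ => rep_smul ((e i).2 m).1 ?_
  rw [AdicCompletion.evalₐ_mk]
  rfl

/-- The basis of the Tate module. -/
def basis : Module.Basis (Fin r) (Compl p) (TateModule p V) :=
  Module.Basis.mk (v := e)
    (by
      rw [Fintype.linearIndependent_iff]
      intro a ha i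
      refine AdicCompletion.ext_evalₐ fun m => ?_
      have h1 := congrFun (congrArg Subtype.val ha) m
      rw [tate_sum_apply] at h1
      have h2 := h.indep_pow m _ h1 i
      rw [map_zero, ← rep_spec, Ideal.Quotient.eq_zero_iff_mem, Ideal.span_singleton_pow,
        Ideal.mem_span_singleton]
      exact h2)
    (by
      rintro x -
      obtain ⟨a, rfl⟩ := h.existsUnique_coord x
      exact Submodule.sum_mem _ fun i _ => Submodule.smul_mem _ _ (Submodule.subset_span ⟨i, rfl⟩))

lemma basis_apply (i : Fin r) : h.basis i = e i := Module.Basis.mk_apply _ _ i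

end IsTateBasis

/-- Repeated division by `p`, starting from `v`. The auxiliary `y m` is the component at level `m +
1`; level `0` is filled with `0`. -/
lemma exists_tate_of_surjective (hs : ∀ m (v : V), p ^ m • v = 0 → ∃ w, p • w = v) (v : V)
    (hv : p • v = 0) : ∃ x : TateModule p V, x.1 1 = v := by
  let y : ∀ m : ℕ, {v : V // p ^ (m + 1) • v = 0} := fun m => Nat.rec ⟨v, by simpa using hv⟩
    (fun m w => ⟨(hs _ w.1 w.2).choose, by
      rw [pow_succ, mul_smul, (hs _ w.1 w.2).choose_spec, w.2]⟩) m
  have hy : ∀ m, p • (y (m + 1)).1 = (y m).1 := fun m => (hs _ (y m).1 (y m).2).choose_spec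
  refine ⟨⟨fun m => Nat.casesOn m 0 fun i => (y i).1, fun m => ?_⟩, rfl⟩
  cases m with
  | zero => exact ⟨by simp, hv⟩
  | succ m => exact ⟨(y m).2, hy m⟩

end tatefree

/-! ### Descent from `H[X]` to `K[X]`, dimension counts and determinants modulo `p ^ m`. -/

section generic

lemma C_smul {F V : Type*} [Field F] [AddCommGroup V] [Module F V] [Module F[X] V]
    [IsScalarTower F F[X] V] (c : F) (v : V) : (C c : F[X]) • v = c • v :=
  algebraMap_smul F[X] c v

variable {K H : Type*} [Field K] [Field H] [Algebra K H]

/-- A polynomial over `H` which is congruent modulo all powers of `p ∈ K[X]` to polynomials over `K`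
has its coefficients in `K`. -/
lemma exists_map_eq_of_dvd_sub {p : K[X]} (hp : p.Monic) (hdeg : 0 < p.natDegree) (P : H[X])
    (c : ℕ → K[X])
    (h : ∀ m, (p ^ m).map (algebraMap K H) ∣ P - (c m).map (algebraMap K H)) :
    ∃ P₀ : K[X], P₀.map (algebraMap K H) = P ∧ ∀ m, p ^ m ∣ P₀ - c m := by
  -- For this `m` the degree of `p ^ m` exceeds that of `P`. The remainder of `c m` modulo `p ^ m`
  -- is congruent to `P` and also has smaller degree than `p ^ m`, so it equals `P`.
  obtain ⟨m, hm⟩ : ∃ m, m = P.natDegree + 1 := ⟨_, rfl⟩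
  have hpm : (p ^ m).Monic := hp.pow m
  have hdm : P.natDegree < (p ^ m).natDegree := by
    rw [hp.natDegree_pow]
    nlinarith
  have hP : (c m %ₘ p ^ m).map (algebraMap K H) = P := by
    have h1 : (p ^ m).map (algebraMap K H) ∣ P - (c m %ₘ p ^ m).map (algebraMap K H) := by
      have h2 : P - (c m %ₘ p ^ m).map (algebraMap K H) = (P - (c m).map (algebraMap K H)) +
          (p ^ m).map (algebraMap K H) * (c m /ₘ p ^ m).map (algebraMap K H) := by
        rw [← Polynomial.map_mul]
        conv_rhs => rw [← modByMonic_add_div (c m) (p ^ m), Polynomial.map_add]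
        rw [modByMonic_add_div]
        ring
      rw [h2]
      exact dvd_add (h m) (dvd_mul_right _ _)
    refine (sub_eq_zero.mp (eq_zero_of_dvd_of_degree_lt h1 ?_)).symm
    rw [degree_map]
    refine (degree_sub_le _ _).trans_lt (max_lt ?_ ?_)
    · refine degree_le_natDegree.trans_lt ?_
      rw [degree_eq_natDegree hpm.ne_zero]
      exact_mod_cast hdm
    · rw [degree_map]
      exact degree_modByMonic_lt _ hpm
  refine ⟨c m %ₘ p ^ m, hP, fun m' => ?_⟩
  rw [← Polynomial.map_dvd_map' (algebraMap K H), Polynomial.map_sub, hP]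
  exact h m'

section tatedim

variable {E : Type*} [AddCommGroup E] [Module K E] [Module K[X] E] [IsScalarTower K K[X] E]
  {p : K[X]} {r : ℕ}

/-- Multiplication by `p` from `E[p^(m+1)]` to `E[p^m]` has kernel inside `E[p]`. With the given
dimensions, rank–nullity leaves an image at least as large as `E[p^m]`. -/
lemma exists_smul_eq_of_finrank
    (hfin : ∀ m, 1 ≤ m → Module.Finite K (LinearMap.ker (LinearMap.lsmul K[X] E (p ^ m))))
    (hdim : ∀ m, 1 ≤ m → Module.finrank K (LinearMap.ker (LinearMap.lsmul K[X] E (p ^ m))) =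
      r * (m * p.natDegree)) (m : ℕ) (v : E) (hv : p ^ m • v = 0) : ∃ w, p • w = v := by
  rcases Nat.eq_zero_or_pos m with rfl | hm
  · exact ⟨0, by rw [smul_zero, ← hv, pow_zero, one_smul]⟩
  let V := fun m => LinearMap.ker (LinearMap.lsmul K[X] E (p ^ m))
  have := hfin m hm
  have := hfin (m + 1) (by omega)
  have := hfin 1 le_rfl
  let f : V (m + 1) →ₗ[K] V m := ((LinearMap.lsmul K[X] E p).restrict (fun x hx => by
    change p ^ m • p • x = 0
    rw [← mul_smul, ← pow_succ]
    exact hx)).restrictScalars K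
  have h1 : Module.finrank K (LinearMap.ker f) ≤ Module.finrank K (V 1) := by
    let g : LinearMap.ker f →ₗ[K] V 1 :=
      { toFun x := ⟨x.1.1, by
          have : p • x.1.1 = 0 := congrArg Subtype.val x.2
          change p ^ 1 • x.1.1 = 0
          rwa [pow_one]⟩
        map_add' _ _ := rfl
        map_smul' _ _ := rfl }
    exact LinearMap.finrank_le_finrank_of_injective (f := g)
      fun x y hxy => Subtype.ext (Subtype.ext (congrArg (fun z : V 1 => (z : E)) hxy))
  have h2 := LinearMap.finrank_range_add_finrank_ker f
  have h3 : Module.finrank K (LinearMap.range f) = Module.finrank K (V m) := by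
    refine le_antisymm (Submodule.finrank_le _) ?_
    rw [hdim 1 le_rfl] at h1
    rw [hdim (m + 1) (by omega)] at h2
    rw [hdim m hm]
    nlinarith
  have h4 := LinearMap.range_eq_top.mp (Submodule.eq_top_of_finrank_eq h3)
  obtain ⟨w, hw⟩ := h4 ⟨v, hv⟩
  exact ⟨w.1, congrArg Subtype.val hw⟩

/-- `E[p]` is a vector space over the field `K[X]/(p)`, of dimension `r` by the tower law.
Divisibility of the `p`-power torsion lifts a basis of it to the Tate module. -/
lemma exists_isTateBasis (hp : Irreducible p)
    (hfin : ∀ m, 1 ≤ m → Module.Finite K (LinearMap.ker (LinearMap.lsmul K[X] E (p ^ m))))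
    (hdim : ∀ m, 1 ≤ m → Module.finrank K (LinearMap.ker (LinearMap.lsmul K[X] E (p ^ m))) =
      r * (m * p.natDegree)) :
    ∃ e : Fin r → TateModule p E, IsTateBasis e := by
  let T := Submodule.torsionBy K[X] E p
  let k := K[X] ⧸ Ideal.span {p}
  have : (Ideal.span {p}).IsMaximal := PrincipalIdealRing.isMaximal_of_irreducible hp
  let : Field k := Ideal.Quotient.field _
  let : Module k T := inferInstanceAs (Module (K[X] ⧸ K[X] ∙ p) T)
  have hmk : ∀ (a : K[X]) (x : T), (Ideal.Quotient.mk (Ideal.span {p}) a : k) • x = a • x :=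
    fun a x => rfl
  have : IsScalarTower K k T := ⟨fun c a x => by
    obtain ⟨a, rfl⟩ := Ideal.Quotient.mk_surjective a
    rw [hmk, ← smul_assoc, ← hmk]
    rfl⟩
  have hT : T = LinearMap.ker (LinearMap.lsmul K[X] E (p ^ 1)) := by
    ext x
    simp [T]
  have : Module.Finite K T := hT ▸ hfin 1 le_rfl
  have hTr : Module.finrank K T = r * p.natDegree := by
    rw [hT, hdim 1 le_rfl, one_mul]
  have hk : Module.finrank K k = p.natDegree := finrank_quotient_span_eq_natDegree
  have hmul := Module.finrank_mul_finrank K k T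
  rw [hTr, hk, mul_comm] at hmul
  have hr : Module.finrank k T = r :=
    Nat.eq_of_mul_eq_mul_right hp.natDegree_pos hmul
  have : Module.Finite k T := Module.Finite.of_restrictScalars_finite K k T
  let b : Module.Basis (Fin r) k T := Module.finBasisOfFinrankEq k T hr
  choose e he using fun i => exists_tate_of_surjective
    (exists_smul_eq_of_finrank hfin hdim) (b i).1 (b i).2
  refine ⟨e, fun a ha i => ?_, fun v hv => ?_⟩
  · simp only [he] at ha
    have h1 : ∑ i, (Ideal.Quotient.mk (Ideal.span {p}) (a i) : k) • b i = 0 := by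
      apply Subtype.ext
      simp only [hmk]
      rw [Submodule.coe_sum]
      exact ha
    have h2 := Fintype.linearIndependent_iff.mp b.linearIndependent _ h1 i
    rwa [Ideal.Quotient.eq_zero_iff_mem, Ideal.mem_span_singleton] at h2
  · choose a ha using fun i => Ideal.Quotient.mk_surjective (b.repr ⟨v, hv⟩ i)
    refine ⟨a, ?_⟩
    have h1 := congrArg Subtype.val (b.sum_repr ⟨v, hv⟩)
    simp only [← ha] at h1
    rw [Submodule.coe_sum] at h1
    simp only [he]
    exact h1.symm

end tatedim

/-- Vectors in the source of a `K[X]`-semilinear embedding onto fixed points which are linearly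
independent over `K` have linearly independent images over `H`. -/
lemma linearIndependent_of_fixed_polynomial {σ : H →+* H}
    (hσ : ∀ c : H, σ c = c → ∃ k : K, algebraMap K H k = c)
    {E Q : Type*} [AddCommGroup E] [Module K E] [Module K[X] E] [IsScalarTower K K[X] E]
    [AddCommGroup Q] [Module H Q] [Module H[X] Q] [IsScalarTower H H[X] Q]
    (S : Q →ₛₗ[mapRingHom σ] Q) (j : E →ₛₗ[mapRingHom (algebraMap K H)] Q)
    (hj : Function.Injective j) (hS : ∀ x, S (j x) = j x) {ι : Type*} {v : ι → E}
    (hv : LinearIndependent K v) : LinearIndependent H (fun i => j (v i)) :=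
  linearIndependent_of_fixed hσ
    { toFun := S
      map_add' := map_add S
      map_smul' c x := by
        rw [← C_smul, LinearMap.map_smulₛₗ, coe_mapRingHom, map_C, C_smul] }
    { toFun := j
      map_add' := map_add j
      map_smul' c x := by
        rw [← C_smul, LinearMap.map_smulₛₗ, coe_mapRingHom, map_C, C_smul] } hj hS hv

/-- A semilinear embedding whose source is free over `K[X]/(p^m)` generates a target of the same
dimension. -/
lemma span_eq_top_of_isTateBasis {σ : H →+* H}
    (hσ : ∀ c : H, σ c = c → ∃ k : K, algebraMap K H k = c)
    {E : Type*} [AddCommGroup E] [Module K E] [Module K[X] E] [IsScalarTower K K[X] E]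
    {p : K[X]} (hp : p.Monic) {r : ℕ} {e : Fin r → TateModule p E} (he : IsTateBasis e) (m : ℕ)
    {Q : Type*} [AddCommGroup Q] [Module H Q] [Module H[X] Q] [IsScalarTower H H[X] Q]
    [Module.Finite H Q] (hQ : Module.finrank H Q = r * (m * p.natDegree))
    (S : Q →ₛₗ[mapRingHom σ] Q)
    (j : LinearMap.ker (LinearMap.lsmul K[X] E (p ^ m)) →ₛₗ[mapRingHom (algebraMap K H)] Q)
    (hj : Function.Injective j) (hS : ∀ x, S (j x) = j x) :
    Submodule.span H[X] (Set.range fun i => j ⟨(e i).1 m, ((e i).2 m).1⟩) = ⊤ := by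
  let v : Fin r → LinearMap.ker (LinearMap.lsmul K[X] E (p ^ m)) :=
    fun i => ⟨(e i).1 m, ((e i).2 m).1⟩
  -- A `K`-relation among these vectors amounts to polynomials of degree below that of `p ^ m` which
  -- `p ^ m` divides, hence is trivial. Their number is the dimension of `Q`, so their images form
  -- an `H`-basis.
  let u : Fin r × Fin (m * p.natDegree) → LinearMap.ker (LinearMap.lsmul K[X] E (p ^ m)) :=
    fun x => (X : K[X]) ^ (x.2 : ℕ) • v x.1
  have hu : LinearIndependent K u := by
    rw [Fintype.linearIndependent_iff]
    intro c hc
    let a : Fin r → K[X] := fun i => ∑ k : Fin (m * p.natDegree), C (c (i, k)) * X ^ (k : ℕ)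
    have h1 : ∑ i, a i • v i = 0 := by
      rw [← hc, Fintype.sum_prod_type]
      refine Finset.sum_congr rfl fun i _ => ?_
      rw [Finset.sum_smul]
      refine Finset.sum_congr rfl fun k _ => ?_
      rw [mul_smul, C_smul]
    have h2 : ∑ i, a i • (e i).1 m = 0 := by
      have := congrArg Subtype.val h1
      rwa [Submodule.coe_sum] at this
    have h3 : ∀ i, a i = 0 := fun i => by
      refine eq_zero_of_dvd_of_degree_lt (he.indep_pow m a h2 i) ?_
      rw [degree_eq_natDegree (hp.pow m).ne_zero, hp.natDegree_pow]
      exact degree_sum_fin_lt _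
    rintro ⟨i, k⟩
    have h4 := congrArg (fun q : K[X] => q.coeff k) (h3 i)
    simpa [a, finsetSum_coeff, coeff_C_mul, coeff_X_pow, Fin.val_inj] using h4
  have h5 := linearIndependent_of_fixed_polynomial hσ S j hj hS hu
  have h6 : Submodule.span H (Set.range fun x => j (u x)) = ⊤ :=
    h5.span_eq_top_of_card_eq_finrank' (by simp [hQ])
  rw [eq_top_iff]
  rintro q -
  have h7 : q ∈ Submodule.span H (Set.range fun x => j (u x)) := h6 ▸ Submodule.mem_top
  refine Submodule.span_induction ?_ (zero_mem _) (fun _ _ _ _ => add_mem) (fun c x _ hx => ?_) h7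
  · rintro _ ⟨⟨i, k⟩, rfl⟩
    change j ((X : K[X]) ^ (k : ℕ) • v i) ∈ _
    rw [LinearMap.map_smulₛₗ]
    exact Submodule.smul_mem _ _ (Submodule.subset_span ⟨i, rfl⟩)
  · rw [← C_smul]
    exact Submodule.smul_mem _ _ hx

/-- Determinants modulo `p` of an endomorphism of a free module, computed on generators of the
quotient modulo `p`. -/
lemma dvd_det_sub_det {R : Type*} [CommRing R] {N : Type*} [AddCommGroup N] [Module R N] {r : ℕ}
    (b : Module.Basis (Fin r) R N) (p : R) (Φ : N →ₗ[R] N) (n : Fin r → N)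
    (hn : ∀ x, ∃ (a : Fin r → R) (y : N), x = ∑ i, a i • n i + p • y)
    (C : Matrix (Fin r) (Fin r) R) (hC : ∀ i, ∃ y, Φ (n i) = ∑ j, C j i • n j + p • y) :
    p ∣ LinearMap.det (1 - Φ) - (1 - C).det := by
  let q := Ideal.Quotient.mk (Ideal.span {p})
  let B := LinearMap.toMatrix b b Φ
  -- `G` lists the coordinates of the generators. Modulo `p` it is invertible, because the
  -- generators span, and `B G = G C`; so `1 - B` and `1 - C` are conjugate there.
  let G : Matrix (Fin r) (Fin r) R := Matrix.of fun k i => b.repr (n i) k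
  have hq : ∀ y : R, q (p * y) = 0 := fun y => by
    rw [Ideal.Quotient.eq_zero_iff_mem, Ideal.mem_span_singleton]
    exact dvd_mul_right p y
  choose a y hy using fun k => hn (b k)
  choose z hz using hC
  let A : Matrix (Fin r) (Fin r) R := Matrix.of fun i k => a k i
  have h1 : G.map q * A.map q = 1 := by
    ext l k
    have := congrArg (fun x => q (b.repr x l)) (hy k)
    simp only [map_add, map_sum, map_smul, Finsupp.add_apply, Finsupp.finsetSum_apply,
      Finsupp.smul_apply, smul_eq_mul, map_mul, b.repr_self] at this
    rw [← map_mul q p, hq, add_zero] at this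
    rw [Matrix.mul_apply]
    simp only [Matrix.map_apply, G, A, Matrix.of_apply]
    rw [Matrix.one_apply, Finset.sum_congr rfl fun i _ => mul_comm _ _, ← this,
      Finsupp.single_apply, apply_ite q, map_one, map_zero]
    simp only [eq_comm]
  have h2 : B.map q * G.map q = G.map q * C.map q := by
    ext l i
    have := congrArg (fun x => q (b.repr x l)) (hz i)
    simp only [map_add, map_sum, map_smul, Finsupp.add_apply, Finsupp.finsetSum_apply,
      Finsupp.smul_apply, smul_eq_mul, map_mul] at this
    rw [← map_mul q p, hq, add_zero] at this
    have h3 : B.mulVec (b.repr (n i)) = b.repr (Φ (n i)) :=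
      LinearMap.toMatrix_mulVec_repr b b Φ (n i)
    have h4 := congrArg q (congrFun h3 l)
    rw [Matrix.mulVec, dotProduct, map_sum] at h4
    rw [Matrix.mul_apply, Matrix.mul_apply]
    simp only [Matrix.map_apply, G, Matrix.of_apply, ← map_mul]
    rw [h4, this]
    exact Finset.sum_congr rfl fun j _ => by rw [map_mul, mul_comm]
  have h5 : (1 - B.map q) * G.map q = G.map q * (1 - C.map q) := by
    rw [sub_mul, mul_sub, h2, one_mul, mul_one]
  have h6 : IsUnit (G.map q).det :=
    IsUnit.of_mul_eq_one _ (by rw [← Matrix.det_mul, h1, Matrix.det_one])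
  have h7 : (1 - B.map q).det = (1 - C.map q).det := by
    have := congrArg Matrix.det h5
    rw [Matrix.det_mul, Matrix.det_mul, mul_comm] at this
    exact h6.mul_left_cancel this
  have h8 : ∀ M : Matrix (Fin r) (Fin r) R, q ((1 - M).det) = (1 - M.map q).det := fun M => by
    rw [RingHom.map_det, map_sub, map_one]
    rfl
  rw [← Ideal.mem_span_singleton, ← Ideal.Quotient.eq, ← LinearMap.det_toMatrix b]
  have h9 : LinearMap.toMatrix b b (1 - Φ) = 1 - B := by
    rw [map_sub, LinearMap.toMatrix_one]
  rw [h9]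
  exact (h8 B).trans (h7.trans (h8 C).symm)

end generic

/-! ### The characteristic polynomial on the Tate module. -/

section tatecharpoly

variable {K H : Type*} [Field K] [Field H] [Algebra K H] {σ : H →+* H}

/-- Independence of fixed vectors over `H` bounds the dimension of `E` above; the family `v` bounds
it below. -/
lemma finrank_eq_of_fixed (hσ : ∀ c : H, σ c = c → ∃ k : K, algebraMap K H k = c)
    {E Q : Type*} [AddCommGroup E] [Module K E] [Module K[X] E] [IsScalarTower K K[X] E]
    [AddCommGroup Q] [Module H Q] [Module H[X] Q] [IsScalarTower H H[X] Q] [Module.Finite H Q]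
    (S : Q →ₛₗ[mapRingHom σ] Q) (j : E →ₛₗ[mapRingHom (algebraMap K H)] Q)
    (hj : Function.Injective j) (hS : ∀ x, S (j x) = j x) {κ : Type*} [Fintype κ] {v : κ → E}
    (hv : LinearIndependent K v) (hκ : Fintype.card κ = Module.finrank H Q) :
    Module.Finite K E ∧ Module.finrank K E = Module.finrank H Q := by
  have h1 : Module.rank K E ≤ (Module.finrank H Q : ℕ) := by
    refine rank_le fun s hs => ?_
    have := (linearIndependent_of_fixed_polynomial hσ S j hj hS hs).fintype_card_le_finrank
    rwa [Fintype.card_coe] at this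
  have h2 : Module.Finite K E :=
    Module.rank_lt_aleph0_iff.mp (h1.trans_lt (Cardinal.natCast_lt_aleph0))
  refine ⟨h2, le_antisymm (Module.finrank_le_of_rank_le h1) ?_⟩
  rw [← hκ]
  exact hv.fintype_card_le_finrank

/-- A semilinear embedding between spaces of equal dimension preserves the characteristic
polynomial of `X`. -/
lemma charpoly_mulX_map (hσ : ∀ c : H, σ c = c → ∃ k : K, algebraMap K H k = c)
    {E Q : Type*} [AddCommGroup E] [Module K E] [Module K[X] E] [IsScalarTower K K[X] E]
    [AddCommGroup Q] [Module H Q] [Module H[X] Q] [IsScalarTower H H[X] Q]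
    [Module.Finite H Q] [Module.Finite K E] (hQ : Module.finrank K E = Module.finrank H Q)
    (S : Q →ₛₗ[mapRingHom σ] Q) (j : E →ₛₗ[mapRingHom (algebraMap K H)] Q)
    (hj : Function.Injective j) (hS : ∀ x, S (j x) = j x) :
    (mulX H Q).charpoly = (mulX K E).charpoly.map (algebraMap K H) := by
  classical
  let b := Module.finBasis K E
  have hb := linearIndependent_of_fixed_polynomial hσ S j hj hS b.linearIndependent
  -- Equality of dimensions turns the image of a `K`-basis into an `H`-basis, in which `X` has the
  -- same matrix.
  let b' : Module.Basis _ H Q := Module.Basis.mk hb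
    (hb.span_eq_top_of_card_eq_finrank' (by rw [Fintype.card_fin, hQ])).ge
  have hb' : ∀ i, b' i = j (b i) := fun i => Module.Basis.mk_apply _ _ i
  rw [← LinearMap.charpoly_toMatrix _ b', ← LinearMap.charpoly_toMatrix _ b, ← Matrix.charpoly_map]
  congr 1
  ext i k
  have h1 : mulX H Q (b' k) = ∑ i, algebraMap K H (LinearMap.toMatrix b b (mulX K E) i k) • b' i := by
    have h2 : mulX K E (b k) = ∑ i, LinearMap.toMatrix b b (mulX K E) i k • b i := by
      conv_lhs => rw [← b.sum_repr (mulX K E (b k))]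
      exact Finset.sum_congr rfl fun i _ => by rw [LinearMap.toMatrix_apply]
    have h3 := congrArg j h2
    simp only [map_sum, ← C_smul, LinearMap.map_smulₛₗ, coe_mapRingHom, map_C] at h3
    simp only [C_smul] at h3
    simp only [hb']
    refine Eq.trans ?_ h3
    change (X : H[X]) • j (b k) = j ((X : K[X]) • b k)
    rw [LinearMap.map_smulₛₗ, coe_mapRingHom, map_X]
  rw [LinearMap.toMatrix_apply, h1, b'.repr_sum_self]
  rfl

lemma smul_sum_tate {R : Type*} [CommRing R] {p : R} {V : Type*} [AddCommGroup V] [Module R V]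
    {r : ℕ} (b : Module.Basis (Fin r) (Compl p) (TateModule p V)) (Φ : V →ₗ[R] V) (i : Fin r)
    (m : ℕ) :
    Φ ((b i).1 m) = ∑ j, rep (LinearMap.toMatrix b b (TateModule.map Φ) j i) m • (b j).1 m := by
  rw [← tate_sum_apply]
  have h := b.sum_repr (TateModule.map (p := p) Φ (b i))
  simp only [LinearMap.toMatrix_apply]
  rw [h]
  rfl

lemma evalₐ_det_one_sub {R : Type*} [CommRing R] {p : R} {r : ℕ}
    (C : Matrix (Fin r) (Fin r) (Compl p)) (m : ℕ) :
    AdicCompletion.evalₐ (Ideal.span {p}) m (1 - C).det =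
      Ideal.Quotient.mk (Ideal.span {p} ^ m) (1 - C.map fun a => rep a m).det := by
  have h1 := RingHom.map_det (AdicCompletion.evalₐ (Ideal.span {p}) m).toRingHom (1 - C)
  rw [RingHom.map_det]
  refine h1.trans (congrArg Matrix.det ?_)
  rw [map_sub, map_sub, map_one, map_one]
  congr 1
  ext i j
  exact (rep_spec _ _).symm

namespace SemilinearPresentation

variable {N E : Type*} [AddCommGroup N] [Module H N] [Module H[X] N] [IsScalarTower H H[X] N]
  [AddCommGroup E] [Module K E] [Module K[X] E] [IsScalarTower K K[X] E]
  [Module.Free H[X] N] [Module.Finite H[X] N] {r : ℕ}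

/-- Lifts to `N` of the snake images of the level-`m` components of the Tate basis generate `N`
modulo `p ^ m`. On them `Φ` acts by the Tate matrix of `ΦE` reduced modulo `p ^ m`, since the snake
map transports `ΦE` to `Φ`. -/
lemma dvd_det_sub_det_tate (D : SemilinearPresentation (K := K) σ N E)
    (hσ : ∀ c : H, σ c = c ↔ ∃ k : K, algebraMap K H k = c)
    (b : Module.Basis (Fin r) H[X] N)
    {Φ : N →ₗ[H[X]] N} (hΦS : ∀ n, Φ (D.S n) = D.S (Φ n))
    {ΦE : E →ₗ[K[X]] E} (hΦ : ∀ n, D.ε (Φ n) = ΦE (D.ε n))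
    {p : K[X]} (hp : p.Monic) {e : Fin r → TateModule p E} (he : IsTateBasis e) (m : ℕ) :
    (p ^ m).map (algebraMap K H) ∣ LinearMap.det (1 - Φ) -
      ((1 - (LinearMap.toMatrix he.basis he.basis (TateModule.map ΦE)).map
        fun a => rep a m).det).map (algebraMap K H) := by
  have hσK : ∀ k : K, σ (algebraMap K H k) = algebraMap K H k := fun k => (hσ _).mpr ⟨k, rfl⟩
  let q : H[X] := (p ^ m).map (algebraMap K H)
  have hq : q ≠ 0 := ((hp.pow m).map _).ne_zero
  let g : N →ₗ[H[X]] N := LinearMap.lsmul H[X] N q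
  have hgi : Function.Injective g := lsmul_injective_of_ne_zero hq
  have hqσ : mapRingHom σ q = q := by
    rw [coe_mapRingHom, Polynomial.map_map, show σ.comp (algebraMap K H) = algebraMap K H from
      RingHom.ext hσK]
  have hgS : ∀ n, g (D.S n) = D.S (g n) := fun n => by
    change q • D.S n = D.S (q • n)
    rw [LinearMap.map_smulₛₗ, hqσ]
  obtain ⟨j, hj, hsn⟩ := exists_snake_map (D := D) hσK hgS hgi
    (gE := LinearMap.lsmul K[X] E (p ^ m)) (fun n => D.ε_smul _ _)
  have := finite_quotient_range (F := H) hgi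
  have hdimQ : Module.finrank H (N ⧸ LinearMap.range g) = r * (m * p.natDegree) := by
    rw [finrank_quotient_lsmul hq, Module.finrank_eq_card_basis b, Fintype.card_fin,
      natDegree_map, hp.natDegree_pow]
  let v : Fin r → LinearMap.ker (LinearMap.lsmul K[X] E (p ^ m)) :=
    fun i => ⟨(e i).1 m, ((e i).2 m).1⟩
  have htop : Submodule.span H[X] (Set.range fun i => j (v i)) = ⊤ :=
    span_eq_top_of_isTateBasis (fun c => (hσ c).mp) hp he m hdimQ (D.quotS hgS) j hj
      fun x => (hsn x).fixed hgS
  choose n hn using fun i => Submodule.Quotient.mk_surjective (LinearMap.range g) (j (v i))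
  let M : Matrix (Fin r) (Fin r) K[X] :=
    (LinearMap.toMatrix he.basis he.basis (TateModule.map ΦE)).map fun a => rep a m
  have key := dvd_det_sub_det b q Φ n (fun x => ?_) (M.map (mapRingHom (algebraMap K H)))
    (fun i => ?_)
  · have h1 : (1 - M.map (mapRingHom (algebraMap K H))).det =
        ((1 - M).det).map (algebraMap K H) := by
      rw [← coe_mapRingHom, RingHom.map_det, map_sub, map_one]
      rfl
    rwa [h1] at key
  · have hx : (Submodule.Quotient.mk x : N ⧸ LinearMap.range g) ∈
        Submodule.span H[X] (Set.range fun i => j (v i)) := htop ▸ Submodule.mem_top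
    obtain ⟨c, hc⟩ := (Submodule.mem_span_range_iff_exists_fun _).mp hx
    have h1 : (Submodule.Quotient.mk x : N ⧸ LinearMap.range g) =
        Submodule.Quotient.mk (∑ i, c i • n i) := by
      rw [← hc, ← Submodule.mkQ_apply, map_sum]
      exact Finset.sum_congr rfl fun i _ => by rw [map_smul, Submodule.mkQ_apply, hn]
    obtain ⟨y, hy⟩ := (Submodule.Quotient.eq _).mp h1
    exact ⟨c, y, by rw [← sub_eq_iff_eq_add']; exact hy.symm⟩
  · have hΦv : ΦE (v i : E) = ((∑ k, M k i • v k : LinearMap.ker (LinearMap.lsmul K[X] E (p ^ m))) :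
        E) := by
      have := smul_sum_tate he.basis ΦE i m
      simp only [he.basis_apply] at this
      rw [Submodule.coe_sum]
      exact this
    have hΦg : ∀ n, Φ (g n) = g (Φ n) := fun n => map_smul Φ q n
    have h1 := (hsn (v i)).map hΦS hΦg hΦ
    rw [hΦv] at h1
    have h2 := h1.unique hσK hgS hgi (hsn _)
    rw [← hn i, map_sum] at h2
    have h3 : (Submodule.Quotient.mk (Φ (n i)) : N ⧸ LinearMap.range g) =
        Submodule.Quotient.mk (∑ k, M.map (mapRingHom (algebraMap K H)) k i • n k) := by
      refine h2.trans ?_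
      rw [← Submodule.mkQ_apply, map_sum]
      exact Finset.sum_congr rfl fun k _ => by
        rw [LinearMap.map_smulₛₗ j, map_smul, Submodule.mkQ_apply, hn]; rfl
    obtain ⟨y, hy⟩ := (Submodule.Quotient.eq _).mp h3
    exact ⟨y, by rw [← sub_eq_iff_eq_add']; exact hy.symm⟩

/-- The value at `1` of the characteristic polynomial of an endomorphism of the Tate module, in terms
of the fixed points of this endomorphism. -/
theorem exists_charpoly_eval_one (D : SemilinearPresentation (K := K) σ N E)
    (hσ : ∀ c : H, σ c = c ↔ ∃ k : K, algebraMap K H k = c)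
    (hr : Module.finrank H[X] N = r)
    {Φ : N →ₗ[H[X]] N} (hΦS : ∀ n, Φ (D.S n) = D.S (Φ n))
    {ΦE : E →ₗ[K[X]] E} (hΦ : ∀ n, D.ε (Φ n) = ΦE (D.ε n))
    (hinj : Function.Injective (1 - Φ : N →ₗ[H[X]] N))
    {p : K[X]} (hp : p.Monic) (hirr : Irreducible p)
    (hfin : ∀ m, 1 ≤ m → Module.Finite K (LinearMap.ker (LinearMap.lsmul K[X] E (p ^ m))))
    (hdim : ∀ m, 1 ≤ m → Module.finrank K (LinearMap.ker (LinearMap.lsmul K[X] E (p ^ m))) =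
      r * (m * p.natDegree))
    {E₀ : Type*} [AddCommGroup E₀] [Module K E₀] [Module K[X] E₀] [IsScalarTower K K[X] E₀]
    (ι : E₀ →ₗ[K[X]] E) (hι : Function.Injective ι)
    (hιΦ : ∀ x, ΦE (ι x) = ι x)
    {κ : Type*} [Fintype κ] {v : κ → E₀} (hv : LinearIndependent K v)
    (hκ : Fintype.card κ = Module.finrank H (N ⧸ LinearMap.range (1 - Φ : N →ₗ[H[X]] N))) :
    ∃ (_ : Module.Free (Compl p) (TateModule p E)) (_ : Module.Finite (Compl p) (TateModule p E)),
      Module.finrank (Compl p) (TateModule p E) = r ∧ ∃ P Q : K[X],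
        algebraMap K[X] (Compl p) P = (TateModule.map (p := p) ΦE).charpoly.eval 1 ∧
        Associated P Q ∧ Q.Monic ∧ IsOrder E₀ Q := by
  have hσK : ∀ k : K, σ (algebraMap K H k) = algebraMap K H k := fun k => (hσ _).mpr ⟨k, rfl⟩
  obtain ⟨e, he⟩ := exists_isTateBasis hirr hfin hdim
  have hfree := Module.Free.of_basis he.basis
  have hfinite := Module.Finite.of_basis he.basis
  have hne : Nontrivial (Compl p) := by
    refine ⟨⟨0, 1, fun h => ?_⟩⟩
    have h1 := congrArg (AdicCompletion.evalₐ (Ideal.span {p}) 1) h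
    rw [map_zero, map_one, eq_comm, ← map_one (Ideal.Quotient.mk _),
      Ideal.Quotient.eq_zero_iff_mem, pow_one, Ideal.mem_span_singleton] at h1
    exact hirr.not_isUnit (isUnit_of_dvd_one h1)
  refine ⟨hfree, hfinite, by rw [Module.finrank_eq_card_basis he.basis, Fintype.card_fin], ?_⟩
  let b : Module.Basis (Fin r) H[X] N := Module.finBasisOfFinrankEq H[X] N hr
  -- The determinant of `1 - Φ` descends to a polynomial `P` over `K`. The same congruences identify
  -- `P` in the completion with the determinant on the Tate module.
  obtain ⟨P, hP, hdvd⟩ := exists_map_eq_of_dvd_sub hp hirr.natDegree_pos _ _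
    (D.dvd_det_sub_det_tate hσ b hΦS hΦ hp he)
  have hPe : algebraMap K[X] (Compl p) P = (TateModule.map (p := p) ΦE).charpoly.eval 1 := by
    rw [← LinearMap.charpoly_toMatrix _ he.basis, Matrix.eval_charpoly, map_one]
    refine AdicCompletion.ext_evalₐ fun m => ?_
    rw [evalₐ_det_one_sub, AlgHom.commutes]
    refine Ideal.Quotient.eq.mpr ?_
    rw [Ideal.span_singleton_pow, Ideal.mem_span_singleton]
    exact hdvd m
  have := finite_quotient_range (F := H) hinj
  have h1 := associated_det_charpoly hinj
  have hgS : ∀ n, (1 - Φ : N →ₗ[H[X]] N) (D.S n) = D.S ((1 - Φ : N →ₗ[H[X]] N) n) := fun n => by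
    rw [LinearMap.sub_apply, LinearMap.sub_apply, map_sub, hΦS]
    rfl
  obtain ⟨j, hj, hsn⟩ := exists_snake_map (D := D) hσK hgS hinj
    (gE := 1 - ΦE) (fun n => by
      rw [LinearMap.sub_apply, LinearMap.sub_apply, map_sub, hΦ]
      rfl)
  -- Points of `E₀` are killed by `1 - ΦE`, so they embed in the fixed vectors of the cokernel of `1
  -- - Φ`; the family `v` then forces equal dimensions.
  let ι' : E₀ →ₗ[K[X]] LinearMap.ker (1 - ΦE) := ι.codRestrict _ fun x => by
    rw [LinearMap.mem_ker, LinearMap.sub_apply, hιΦ, Module.End.one_apply, sub_self]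
  have hι' : Function.Injective ι' := fun x y h => hι (congrArg Subtype.val h)
  obtain ⟨hE₀, hcard⟩ := finrank_eq_of_fixed (fun c => (hσ c).mp) (D.quotS hgS) (j.comp ι')
    (hj.comp hι') (fun x => (hsn _).fixed hgS) hv hκ
  rw [← hP, charpoly_mulX_map (fun c => (hσ c).mp) hcard (D.quotS hgS) (j.comp ι')
    (hj.comp hι') (fun x => (hsn _).fixed hgS)] at h1
  -- Divisibility of polynomials is unaffected by extending the field, so the association obtained
  -- over `H` already holds over `K`.
  exact ⟨P, _, hPe, associated_of_dvd_dvd ((Polynomial.map_dvd_map' _).mp h1.dvd)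
    ((Polynomial.map_dvd_map' _).mp h1.symm.dvd), LinearMap.charpoly_monic _, isOrder_charpoly⟩

end SemilinearPresentation

end tatecharpoly

/-! ### Coefficientwise calculus in the three kinds of base ring. -/

section coefficients

/-- The exponents of the monomials of `Base k n F`. -/
def Base.Idx (k : Kind) (n : ℕ) : Type :=
  match k with
  | .rational => Fin n →₀ ℕ
  | .laurent => Fin n →₀ ℕ
  | .iterated => Lex (Fin n → ℤ)

/-- The coefficients of an element of `Base k n F`. -/
def Base.coeff {F : Type*} [Field F] : (k : Kind) → (n : ℕ) → Base.Idx k n → Base k n F →+ F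
  | .rational, _, i => MvPolynomial.coeffAddMonoidHom i
  | .laurent, _, i => (MvPowerSeries.coeff i : MvPowerSeries _ F →ₗ[F] F).toAddMonoidHom
  | .iterated, _, i => HahnSeries.coeff.addMonoidHom i

namespace Base

variable {k : Kind} {n : ℕ} {F F' : Type*} [Field F] [Field F']

lemma ext_coeff {x y : Base k n F} (h : ∀ i, coeff k n i x = coeff k n i y) : x = y := by
  cases k with
  | rational => exact MvPolynomial.ext _ _ h
  | laurent => exact MvPowerSeries.ext h
  | iterated => exact HahnSeries.ext (funext h)

lemma coeff_map (g : F →+* F') (x : Base k n F) (i : Idx k n) :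
    coeff k n i (map k n g x) = g (coeff k n i x) := by
  cases k with
  | rational => exact MvPolynomial.coeff_map g _ _
  | laurent => rfl
  | iterated => rfl

lemma coeff_const_mul (c : F) (x : Base k n F) (i : Idx k n) :
    coeff k n i (const k n c * x) = c * coeff k n i x := by
  cases k with
  | rational => exact MvPolynomial.coeff_C_mul _ _ _
  | laurent => exact MvPowerSeries.coeff_C_mul _ _ _
  | iterated => exact HahnSeries.coeff_single_zero_mul

lemma map_const (g : F →+* F') (c : F) : map k n g (const k n c) = const k n (g c) := by
  cases k with
  | rational => exact MvPolynomial.map_C g c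
  | laurent => exact MvPowerSeries.map_C g c
  | iterated => exact HahnSeries.map_single (g : ZeroHom F F')

/-- An additive map does not enlarge supports, so finiteness or well-orderedness of the support
survives. -/
lemma exists_coeff_eq (φ : F →+ F') (x : Base k n F) :
    ∃ y : Base k n F', ∀ i, coeff k n i y = φ (coeff k n i x) := by
  classical
  cases k with
  | rational =>
    let x' : MvPolynomial (Fin n) F := x
    have h : ∀ i : Fin n →₀ ℕ, MvPolynomial.coeff i (∑ j ∈ x'.support,
        MvPolynomial.monomial j (φ (x'.coeff j))) = φ (x'.coeff i) := fun i => by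
      rw [MvPolynomial.coeff_sum]
      simp only [MvPolynomial.coeff_monomial, Finset.sum_ite_eq']
      split_ifs with h
      · rfl
      · rw [MvPolynomial.notMem_support_iff.mp h, map_zero]
    exact ⟨_, h⟩
  | laurent => exact ⟨fun i => φ (coeff .laurent n i x), fun i => rfl⟩
  | iterated => exact ⟨HahnSeries.map x φ, fun i => rfl⟩

/-- The indexing set depends on `x` and `y` only, so one finite sum serves every pair with smaller
supports; the surplus terms are zero. -/
lemma hahn_coeff_mul {Γ : Type*} [AddCommGroup Γ] [LinearOrder Γ] [IsOrderedAddMonoid Γ]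
    (x y x' y' : HahnSeries Γ F) (hx : ∀ a, x.coeff a = 0 → x'.coeff a = 0)
    (hy : ∀ a, y.coeff a = 0 → y'.coeff a = 0) (i : Γ) :
    (x' * y').coeff i = ∑ a ∈ Finset.antidiagonal x.isPWO_support y.isPWO_support i,
      x'.coeff a.1 * y'.coeff a.2 := by
  rw [HahnSeries.coeff_mul_left' x.isPWO_support (fun a ha h => ha (hx a h))]
  refine Finset.sum_subset (fun a ha => ?_) fun a ha ha' => ?_
  · rw [Finset.mem_antidiagonal] at ha ⊢
    exact ⟨ha.1, fun h => ha.2.1 (hy _ h), ha.2.2⟩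
  · rw [Finset.mem_antidiagonal] at ha ha'
    by_cases h : y'.coeff a.2 = 0
    · rw [h, mul_zero]
    · exact absurd ⟨ha.1, h, ha.2.2⟩ ha'

/-- The coefficients of a product are finite bilinear expressions in those of the factors, and
the terms which occur depend only on the supports of the factors. -/
lemma exists_coeff_mul (x y : Base k n F) (i : Idx k n) :
    ∃ s : Finset (Idx k n × Idx k n), ∀ x' y' : Base k n F,
      (∀ a, coeff k n a x = 0 → coeff k n a x' = 0) →
      (∀ a, coeff k n a y = 0 → coeff k n a y' = 0) →
      coeff k n i (x' * y') = ∑ a ∈ s, coeff k n a.1 x' * coeff k n a.2 y' := by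
  classical
  cases k with
  | rational =>
    exact ⟨Finset.HasAntidiagonal.antidiagonal (A := Fin n →₀ ℕ) i, fun x' y' _ _ =>
      MvPolynomial.coeff_mul _ _ _⟩
  | laurent =>
    exact ⟨Finset.HasAntidiagonal.antidiagonal (A := Fin n →₀ ℕ) i, fun x' y' _ _ =>
      MvPowerSeries.coeff_mul _ _ _⟩
  | iterated =>
    let X : HahnSeries (Lex (Fin n → ℤ)) F := x
    let Y : HahnSeries (Lex (Fin n → ℤ)) F := y
    let m : Lex (Fin n → ℤ) := i
    let s : Finset (Lex (Fin n → ℤ) × Lex (Fin n → ℤ)) :=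
      Finset.antidiagonal X.isPWO_support Y.isPWO_support m
    exact ⟨s, fun x' y' hx hy => hahn_coeff_mul X Y x' y' hx hy m⟩

end Base

end coefficients

/-! ### Fixed elements and constants of `F{Z}`. -/

section fixed

variable {Fq F : Type*} [Field Fq] [Field F] [Algebra Fq F]

/-- A functional on `F` over the fixed field `Fq` of `g` factors through the orbit map of `g`. -/
lemma exists_linearMap_orbit (g : F ≃ₐ[Fq] F)
    (hg : ∀ c : F, g c = c → ∃ a : Fq, algebraMap Fq F a = c) (φ : F →ₗ[Fq] Fq) :
    ∃ Λ : (ℕ → F) →ₗ[F] F, ∀ x, Λ (fun i => (g ^ i) x) = algebraMap Fq F (φ x) := by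
  -- Orbits are fixed by the semilinear operator "shift, then apply `g⁻¹`". The orbits of an
  -- `Fq`-basis are therefore independent over `F`, so a functional on all sequences can be
  -- prescribed on them.
  let S : (ℕ → F) →ₛₗ[(g.symm : F →+* F)] (ℕ → F) :=
    { toFun w i := g.symm (w (i + 1))
      map_add' _ _ := funext fun i => map_add g.symm _ _
      map_smul' _ _ := funext fun i => map_mul g.symm _ _ }
  let j : F →ₛₗ[algebraMap Fq F] (ℕ → F) :=
    { toFun x i := (g ^ i) x
      map_add' _ _ := funext fun i => map_add (g ^ i) _ _
      map_smul' c x := funext fun i => by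
        change (g ^ i) (c • x) = algebraMap Fq F c * (g ^ i) x
        rw [map_smul, Algebra.smul_def] }
  have hj : Function.Injective j := fun x y h => congrFun h 0
  have hS : ∀ x, S (j x) = j x := fun x => funext fun i => by
    change g.symm ((g ^ (i + 1)) x) = (g ^ i) x
    rw [pow_succ', AlgEquiv.mul_apply, AlgEquiv.symm_apply_apply]
  let b := Module.Basis.ofVectorSpace Fq F
  have hli := linearIndependent_of_fixed (σ := (g.symm : F →+* F)) (fun c hc => hg c (by
    conv_lhs => rw [← show g.symm c = c from hc]
    exact g.apply_symm_apply c)) S j hj hS b.linearIndependent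
  obtain ⟨Λ, hΛ⟩ := LinearMap.exists_extend
    ((Module.Basis.span hli).constr F fun i => algebraMap Fq F (φ (b i)))
  have hb : ∀ i, Λ (j (b i)) = algebraMap Fq F (φ (b i)) := fun i => by
    have h1 := (Module.Basis.span hli).constr_basis F (fun i => algebraMap Fq F (φ (b i))) i
    rw [← hΛ] at h1
    rw [← h1, LinearMap.comp_apply, Submodule.subtype_apply, Module.Basis.span_apply]
  refine ⟨Λ, fun x => ?_⟩
  change Λ (j x) = _
  induction b.mem_span x using Submodule.span_induction with
  | mem x hx => obtain ⟨i, rfl⟩ := hx; exact hb i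
  | zero => simp only [map_zero]
  | add x y _ _ hx hy => simp only [map_add, hx, hy]
  | smul c x _ hx =>
    rw [LinearMap.map_smulₛₗ j, map_smul, map_smul, smul_eq_mul, smul_eq_mul, map_mul, hx]

namespace ZField

variable {k : Kind} {n : ℕ}

/-- The elements of `F{Z}` which are fixed by coefficientwise application of `g` are those whose
coefficients lie in the fixed field of `g`. -/
lemma exists_algebraMap_eq_of_fixed (g : F ≃ₐ[Fq] F)
    (hg : ∀ c : F, g c = c → ∃ a : Fq, algebraMap Fq F a = c) (x : ZField k n F)
    (hx : mapAlgEquiv k n g x = x) :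
    ∃ y : ZField k n Fq, algebraMap (ZField k n Fq) (ZField k n F) y = x := by
  obtain ⟨a, b, hb, rfl⟩ := IsFractionRing.div_surjective (A := Base k n F) x
  have hb0 : b ≠ 0 := nonZeroDivisors.ne_zero hb
  have hinj := IsFractionRing.injective (Base k n F) (ZField k n F)
  have hbz : algebraMap (Base k n F) (ZField k n F) b ≠ 0 := fun h =>
    hb0 (hinj (by rw [h, map_zero]))
  have hpow : ∀ (i : ℕ), Base.map k n ((g ^ i : F ≃ₐ[Fq] F) : F →+* F) a * b =
      a * Base.map k n ((g ^ i : F ≃ₐ[Fq] F) : F →+* F) b := fun i => by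
    have h1 : map k n ((g ^ i : F ≃ₐ[Fq] F) : F →+* F) (algebraMap (Base k n F) (ZField k n F) a /
        algebraMap (Base k n F) (ZField k n F) b) = algebraMap (Base k n F) (ZField k n F) a /
        algebraMap (Base k n F) (ZField k n F) b := by
      induction i with
      | zero => exact congrFun (congrArg DFunLike.coe (map_id k n (F := F))) _
      | succ i ih =>
        have h2 : ((g ^ (i + 1) : F ≃ₐ[Fq] F) : F →+* F) =
            ((g ^ i : F ≃ₐ[Fq] F) : F →+* F).comp (g : F →+* F) := by
          rw [pow_succ]; rfl
        rw [h2, ← map_comp, RingHom.comp_apply]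
        conv_rhs => rw [← ih]
        exact congrArg _ hx
    rw [map_div₀, map_algebraMap, map_algebraMap, div_eq_div_iff _ hbz, ← map_mul, ← map_mul] at h1
    · exact hinj h1
    · rw [← map_algebraMap]
      exact (_root_.map_ne_zero _).mpr hbz
  obtain ⟨i₀, hi₀⟩ : ∃ i, Base.coeff k n i b ≠ 0 := by
    by_contra! h
    exact hb0 (Base.ext_coeff fun i => by rw [h i, map_zero])
  -- This `φ` keeps the denominator nonzero. Applying it to all coefficients gives `a'` and `b'`
  -- over `Fq`, and the aim is `x = a' / b'`, which is what `key` says after clearing denominators.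
  obtain ⟨φ, hφ⟩ : ∃ φ : F →ₗ[Fq] Fq, φ (Base.coeff k n i₀ b) ≠ 0 := by
    by_contra! h
    exact hi₀ ((Module.forall_dual_apply_eq_zero_iff Fq _).mp h)
  obtain ⟨Λ, hΛ⟩ := exists_linearMap_orbit g hg φ
  obtain ⟨a', ha'⟩ := Base.exists_coeff_eq φ.toAddMonoidHom a
  obtain ⟨b', hb'⟩ := Base.exists_coeff_eq φ.toAddMonoidHom b
  have ha'' : ∀ i, Base.coeff k n i (Base.map k n (algebraMap Fq F) a') =
      algebraMap Fq F (φ (Base.coeff k n i a)) := fun i => by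
    rw [Base.coeff_map, ha']; rfl
  have hb'' : ∀ i, Base.coeff k n i (Base.map k n (algebraMap Fq F) b') =
      algebraMap Fq F (φ (Base.coeff k n i b)) := fun i => by
    rw [Base.coeff_map, hb']; rfl
  have key : Base.map k n (algebraMap Fq F) a' * b = a * Base.map k n (algebraMap Fq F) b' := by
    refine Base.ext_coeff fun i => ?_
    obtain ⟨s, hs⟩ := Base.exists_coeff_mul a b i
    rw [hs _ _ (fun c hc => by rw [ha'', hc, map_zero, map_zero]) fun _ h => h,
      hs _ _ (fun _ h => h) fun c hc => by rw [hb'', hc, map_zero, map_zero]]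
    -- For fixed `i`, the identities `hpow m` together form one `F`-linear relation between orbits
    -- of coefficients. `Λ` turns each orbit into the value of `φ`.
    have h1 : ∑ c ∈ s, Base.coeff k n c.2 b • (fun i : ℕ => (g ^ i) (Base.coeff k n c.1 a)) =
        ∑ c ∈ s, Base.coeff k n c.1 a • (fun i : ℕ => (g ^ i) (Base.coeff k n c.2 b)) := by
      funext m
      rw [Finset.sum_apply, Finset.sum_apply]
      have h2 := congrArg (Base.coeff k n i) (hpow m)
      rw [hs _ _ (fun c hc => by rw [Base.coeff_map, hc, map_zero]) fun _ h => h,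
        hs _ _ (fun _ h => h) fun c hc => by rw [Base.coeff_map, hc, map_zero]] at h2
      simp only [Base.coeff_map] at h2
      simp only [Pi.smul_apply, smul_eq_mul]
      rw [Finset.sum_congr rfl fun c _ => mul_comm _ _]
      exact h2
    have h3 := congrArg Λ h1
    simp only [map_sum, map_smul, hΛ, smul_eq_mul] at h3
    simp only [ha'', hb'']
    rw [← h3]
    exact Finset.sum_congr rfl fun c _ => mul_comm _ _
  have hb'0 : Base.map k n (algebraMap Fq F) b' ≠ 0 := fun h => by
    have h1 := hb'' i₀
    rw [h, map_zero, eq_comm, map_eq_zero] at h1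
    exact hφ h1
  refine ⟨algebraMap (Base k n Fq) _ a' / algebraMap (Base k n Fq) _ b', ?_⟩
  rw [map_div₀]
  change map k n (algebraMap Fq F) _ / map k n (algebraMap Fq F) _ = _
  rw [map_algebraMap, map_algebraMap, div_eq_div_iff _ hbz, ← map_mul, ← map_mul, key]
  exact fun h => hb'0 (hinj (by rw [h, map_zero]))

/-- Constants which are linearly independent over `𝔽_q` are linearly independent over `𝔽_q{Z}`. -/
lemma linearIndependent_const {ι : Type*} [Fintype ι] {v : ι → F} (hv : LinearIndependent Fq v) :
    LinearIndependent (ZField k n Fq) (fun i => const k n F (v i)) := by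
  have hinj := IsFractionRing.injective (Base k n F) (ZField k n F)
  rw [Fintype.linearIndependent_iff]
  intro c hc i
  -- With denominators cleared, the relation lives in the base ring and can be read coefficient by
  -- coefficient over `Fq`.
  obtain ⟨d, hd⟩ := IsLocalization.exist_integer_multiples_of_finite
    (nonZeroDivisors (Base k n Fq)) c
  choose x hx using hd
  have h1 : ∑ i, const k n F (v i) * algebraMap (Base k n F) (ZField k n F)
      (Base.map k n (algebraMap Fq F) (x i)) = 0 := by
    have h2 : ∀ i, const k n F (v i) * algebraMap (Base k n F) (ZField k n F)
        (Base.map k n (algebraMap Fq F) (x i)) =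
        algebraMap (Base k n F) (ZField k n F) (Base.map k n (algebraMap Fq F) d) *
          (c i • const k n F (v i)) := fun i => by
      rw [← map_algebraMap, ← map_algebraMap, hx i, Algebra.smul_def, map_mul, Algebra.smul_def]
      change _ = _ * (map k n (algebraMap Fq F) (c i) * _)
      ring
    rw [Finset.sum_congr rfl fun i _ => h2 i, ← Finset.mul_sum, hc, mul_zero]
  have h3 : ∑ i, Base.const k n (v i) * Base.map k n (algebraMap Fq F) (x i) = 0 := by
    apply hinj
    rw [map_sum, map_zero, ← h1]
    exact Finset.sum_congr rfl fun i _ => map_mul _ _ _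
  have h4 : ∀ i, x i = 0 := fun i => Base.ext_coeff fun m => by
    have h5 := congrArg (Base.coeff k n m) h3
    simp only [map_sum, map_zero, Base.coeff_const_mul, Base.coeff_map] at h5
    rw [map_zero]
    refine Fintype.linearIndependent_iff.mp hv (fun i => Base.coeff k n m (x i)) ?_ i
    rw [← h5]
    exact Finset.sum_congr rfl fun i _ => by rw [Algebra.smul_def, mul_comm]
  have h6 := hx i
  rw [h4 i, map_zero, Algebra.smul_def, eq_comm, mul_eq_zero] at h6
  refine h6.resolve_left fun h => nonZeroDivisors.coe_ne_zero d ?_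
  exact IsFractionRing.injective (Base k n Fq) (ZField k n Fq) (by rw [h, map_zero])

/-- An irreducible polynomial over `𝔽_q` remains irreducible over `𝔽_q{Z}`. -/
lemma irreducible_map_const {lam : Fq[X]} (hm : lam.Monic) (hirr : Irreducible lam) :
    Irreducible (lam.map (const k n Fq)) := by
  have : Fact (Irreducible lam) := ⟨hirr⟩
  let pb := AdjoinRoot.powerBasis hirr.ne_zero
  let α : ZField k n (AdjoinRoot lam) := const k n (AdjoinRoot lam) (AdjoinRoot.root lam)
  -- The powers of the root below `deg lam` remain independent, so its minimal polynomial over the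
  -- larger field has degree at least `deg lam` and must be the image of `lam`.
  have hli : LinearIndependent (ZField k n Fq) (fun i : Fin lam.natDegree => α ^ (i : ℕ)) := by
    have h1 := linearIndependent_const (k := k) (n := n) pb.basis.linearIndependent
    have h2 : (fun i => const k n (AdjoinRoot lam) (pb.basis i)) =
        fun i : Fin pb.dim => α ^ (i : ℕ) :=
      funext fun i => by rw [pb.basis_eq_pow, map_pow]; rfl
    rw [h2] at h1
    exact h1
  have hroot : aeval α (lam.map (const k n Fq)) = 0 := by
    have h1 : (algebraMap (ZField k n Fq) (ZField k n (AdjoinRoot lam))).comp (const k n Fq) =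
        (const k n (AdjoinRoot lam)).comp (algebraMap Fq (AdjoinRoot lam)) := RingHom.ext fun c => by
      change map k n (algebraMap Fq (AdjoinRoot lam))
        (algebraMap (Base k n Fq) (ZField k n Fq) (Base.const k n c)) =
        algebraMap (Base k n (AdjoinRoot lam)) (ZField k n (AdjoinRoot lam))
          (Base.const k n (algebraMap Fq (AdjoinRoot lam) c))
      rw [map_algebraMap, Base.map_const]
    rw [aeval_def, eval₂_map, h1, ← hom_eval₂]
    change const k n (AdjoinRoot lam) (eval₂ (AdjoinRoot.of lam) (AdjoinRoot.root lam) lam) = 0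
    rw [AdjoinRoot.eval₂_root, map_zero]
  have hmon : (lam.map (const k n Fq)).Monic := hm.map _
  have hint : IsIntegral (ZField k n Fq) α := ⟨_, hmon, hroot⟩
  have hdeg : (lam.map (const k n Fq)).natDegree ≤ (minpoly (ZField k n Fq) α).natDegree := by
    by_contra! h
    rw [natDegree_map] at h
    have h1 := minpoly.aeval (ZField k n Fq) α
    rw [aeval_eq_sum_range' h, ← Fin.sum_univ_eq_sum_range
      (fun i => (minpoly (ZField k n Fq) α).coeff i • α ^ i)] at h1
    have h2 := Fintype.linearIndependent_iff.mp hli _ h1 ⟨_, h⟩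
    rw [coeff_natDegree, leadingCoeff_eq_zero] at h2
    exact minpoly.ne_zero hint h2
  rw [eq_of_monic_of_dvd_of_natDegree_le (minpoly.monic hint) hmon (minpoly.dvd _ _ hroot) hdeg]
  exact minpoly.irreducible hint

end ZField

/-- Over `Fq` the polynomial X^q - X is the product of all `X - a`; evaluate it at `c`. -/
lemma exists_algebraMap_eq_of_pow_card [Fintype Fq] (c : F) (hc : c ^ Fintype.card Fq = c) :
    ∃ a : Fq, algebraMap Fq F a = c := by
  have h := prod_multiset_X_sub_C_of_monic_of_roots_card_eq
    (p := (X ^ Fintype.card Fq - X : Fq[X])) (monic_X_pow_sub (by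
      rw [degree_X]; exact_mod_cast Fintype.one_lt_card)) (by
      rw [FiniteField.roots_X_pow_card_sub_X, FiniteField.X_pow_card_sub_X_natDegree_eq _
        Fintype.one_lt_card]; rfl)
  rw [FiniteField.roots_X_pow_card_sub_X] at h
  have h2 := congrArg (aeval c) h
  rw [map_sub, map_pow, aeval_X, hc, sub_self] at h2
  change aeval c (∏ a : Fq, (X - C a)) = 0 at h2
  rw [map_prod, Finset.prod_eq_zero_iff] at h2
  obtain ⟨a, -, ha⟩ := h2
  rw [map_sub, aeval_X, aeval_C, sub_eq_zero] at ha
  exact ⟨a, ha.symm⟩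

end fixed

/-! ### Division of twisted polynomials and dimensions of cokernels. -/

section skew

variable {K H : Type*} [Field K] [Field H] [Algebra K H] {τ : H →ₐ[K] H}

lemma TwPoly.monomial_mul_monomial (a b : ℕ) (u v : Twisted τ) :
    (SkewPolynomial.monomial a u * SkewPolynomial.monomial b v : TwPoly τ) =
      SkewPolynomial.monomial (a + b) (u * Multiplicative.ofAdd a • v) := by
  rw [SkewPolynomial.monomial_mul_monomial, SkewPolynomial.φ_iterate_apply]

lemma TwPoly.coeff_sum {ι : Type*} (s : Finset ι) (f : ι → TwPoly τ) (m : ℕ) :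
    (∑ i ∈ s, f i).coeff m = ∑ i ∈ s, (f i).coeff m :=
  map_sum (AddMonoidHom.mk' (fun p : TwPoly τ => p.coeff m)
    fun p q => SkewPolynomial.coeff_add p q m) f s

lemma TwPoly.coeff_smul (c : Twisted τ) (p : TwPoly τ) (m : ℕ) :
    (c • p).coeff m = c * p.coeff m := rfl

lemma TwPoly.coeff_monomial_mul (a : ℕ) (u : Twisted τ) (p : TwPoly τ) (m : ℕ) :
    (SkewPolynomial.monomial a u * p : TwPoly τ).coeff m =
      if a ≤ m then u * Multiplicative.ofAdd a • p.coeff (m - a) else 0 := by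
  refine SkewPolynomial.induction (motive := fun p : TwPoly τ =>
    (SkewPolynomial.monomial a u * p : TwPoly τ).coeff m =
      if a ≤ m then u * Multiplicative.ofAdd a • p.coeff (m - a) else 0) p ?_ fun i b q _ _ ih => ?_
  · simp
  · rw [mul_add, SkewPolynomial.coeff_add, ih, TwPoly.monomial_mul_monomial,
      SkewPolynomial.coeff_monomial, SkewPolynomial.coeff_add, SkewPolynomial.coeff_monomial]
    by_cases h : a ≤ m
    · rw [if_pos h, if_pos h, smul_add, mul_add]
      congr 1
      by_cases h2 : i = m - a
      · rw [if_pos h2, if_pos (by omega)]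
      · rw [if_neg h2, if_neg (by omega), smul_zero, mul_zero]
    · rw [if_neg h, if_neg h, if_neg (by omega), add_zero]

lemma TwPoly.coeff_mul (q p : TwPoly τ) (m : ℕ) :
    (q * p).coeff m = ∑ a ∈ q.support,
      if a ≤ m then q.coeff a * Multiplicative.ofAdd a • p.coeff (m - a) else 0 := by
  conv_lhs => rw [← SkewPolynomial.sum_monomial q, SkewPolynomial.sum_def, Finset.sum_mul,
    TwPoly.coeff_sum]
  exact Finset.sum_congr rfl fun a _ => TwPoly.coeff_monomial_mul a _ p m

lemma coeff_eq_zero_of_tdeg_lt {p : TwPoly τ} {m : ℕ} (h : tdeg p < m) : p.coeff m = 0 := by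
  by_contra hne
  exact absurd (Finset.le_sup (f := id) (SkewPolynomial.mem_support_iff.mpr hne)) (not_le.mpr h)

lemma coeff_tdeg_ne_zero {p : TwPoly τ} (h : p ≠ 0) : p.coeff (tdeg p) ≠ 0 := by
  rw [← SkewPolynomial.mem_support_iff]
  have h1 : p.support.Nonempty := Finset.nonempty_iff_ne_empty.mpr
    (mt SkewPolynomial.support_eq_empty.mp h)
  obtain ⟨i, hi, h2⟩ := Finset.exists_mem_eq_sup p.support h1 id
  rw [tdeg, h2]
  exact hi

lemma tdeg_eq_of_coeff {p : TwPoly τ} {m : ℕ} (h : p.coeff m ≠ 0)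
    (h' : ∀ i, m < i → p.coeff i = 0) : tdeg p = m := by
  refine le_antisymm (Finset.sup_le fun i hi => ?_)
    (Finset.le_sup (f := id) (SkewPolynomial.mem_support_iff.mpr h))
  by_contra hlt
  exact SkewPolynomial.mem_support_iff.mp hi (h' i (not_le.mp hlt))

lemma ofAdd_smul_ne_zero (a : ℕ) {u : Twisted τ} (hu : u ≠ 0) : Multiplicative.ofAdd a • u ≠ 0 :=
  (map_ne_zero_iff ((τ ^ a : H →ₐ[K] H) : H →+* H) (RingHom.injective _)).mpr hu

lemma coeff_mul_tdeg_add (q p : TwPoly τ) :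
    (q * p).coeff (tdeg q + tdeg p) =
      q.coeff (tdeg q) * Multiplicative.ofAdd (tdeg q) • p.coeff (tdeg p) := by
  rw [TwPoly.coeff_mul, Finset.sum_eq_single (tdeg q)]
  · rw [if_pos (Nat.le_add_right _ _), Nat.add_sub_cancel_left]
  · intro a ha hne
    have h1 : a ≤ tdeg q := Finset.le_sup (f := id) ha
    rw [if_pos (by omega), coeff_eq_zero_of_tdeg_lt (p := p) (by omega), smul_zero, mul_zero]
  · intro h
    rw [SkewPolynomial.notMem_support_iff.mp h, zero_mul]
    simp

lemma coeff_mul_tdeg_add_ne_zero {q p : TwPoly τ} (hq : q ≠ 0) (hp : p ≠ 0) :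
    (q * p).coeff (tdeg q + tdeg p) ≠ 0 := by
  rw [coeff_mul_tdeg_add]
  exact mul_ne_zero (coeff_tdeg_ne_zero hq) (ofAdd_smul_ne_zero _ (coeff_tdeg_ne_zero hp))

variable (τ) in
/-- The twisted polynomials of degree less than `m`. -/
def tdegLT (m : ℕ) : Submodule (Twisted τ) (TwPoly τ) where
  carrier := {p | ∀ i, m ≤ i → p.coeff i = 0}
  add_mem' hp hq i hi := by rw [SkewPolynomial.coeff_add, hp i hi, hq i hi, add_zero]
  zero_mem' i _ := rfl
  smul_mem' c p hp i hi := by rw [TwPoly.coeff_smul, hp i hi, mul_zero]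

variable (τ) in
/-- Twisted polynomials of degree less than `m` are determined by `m` coefficients. -/
def tdegLTEquiv (m : ℕ) : tdegLT τ m ≃ₗ[Twisted τ] (Fin m → Twisted τ) where
  toFun p i := p.1.coeff i
  map_add' p q := funext fun i => SkewPolynomial.coeff_add _ _ _
  map_smul' c p := rfl
  invFun v := ⟨∑ i : Fin m, SkewPolynomial.monomial (i : ℕ) (v i), fun j hj => by
    rw [TwPoly.coeff_sum]
    exact Finset.sum_eq_zero fun i _ => by
      rw [SkewPolynomial.coeff_monomial, if_neg (by omega)]⟩
  left_inv p := by
    refine Subtype.ext (SkewPolynomial.ext fun j => ?_)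
    change (∑ i : Fin m, SkewPolynomial.monomial (i : ℕ) (p.1.coeff i) : TwPoly τ).coeff j = _
    rw [TwPoly.coeff_sum]
    simp only [SkewPolynomial.coeff_monomial]
    by_cases hj : j < m
    · rw [Finset.sum_eq_single ⟨j, hj⟩ (fun b _ hb => if_neg fun h => hb (Fin.ext h))
        fun h => absurd (Finset.mem_univ _) h, if_pos rfl]
    · rw [p.2 j (not_lt.mp hj)]
      exact Finset.sum_eq_zero fun i _ => if_neg (by omega)
  right_inv v := by
    funext j
    change (∑ i : Fin m, SkewPolynomial.monomial (i : ℕ) (v i) : TwPoly τ).coeff j = _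
    rw [TwPoly.coeff_sum]
    simp only [SkewPolynomial.coeff_monomial]
    rw [Finset.sum_eq_single j (fun b _ hb => if_neg fun h => hb (Fin.ext h))
        fun h => absurd (Finset.mem_univ _) h, if_pos rfl]

lemma finite_tdegLT (m : ℕ) : Module.Finite (Twisted τ) (tdegLT τ m) :=
  Module.Finite.equiv (tdegLTEquiv τ m).symm

lemma finrank_tdegLT (m : ℕ) : Module.finrank (Twisted τ) (tdegLT τ m) = m := by
  rw [(tdegLTEquiv τ m).finrank_eq, Module.finrank_fin_fun]

lemma not_finite_twPoly : ¬ Module.Finite (Twisted τ) (TwPoly τ) := by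
  intro h
  have := Submodule.finrank_le (tdegLT τ (Module.finrank (Twisted τ) (TwPoly τ) + 1))
  rw [finrank_tdegLT] at this
  omega

/-- Right multiplication by a twisted polynomial. -/
def mulRight (p : TwPoly τ) : Module.End (Twisted τ) (TwPoly τ) where
  toFun q := q * p
  map_add' q q' := add_mul q q' p
  map_smul' c q := smul_mul_assoc c q p

/-- Division with remainder. Degrees add in products, so a nonzero multiple of `p` is never of
smaller degree, and leading terms can be removed by left multiples of `p`. Only injectivity of `τ`
is needed. -/
lemma isCompl_tdegLT_range {p : TwPoly τ} (hp : p ≠ 0) :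
    IsCompl (LinearMap.range (mulRight p)) (tdegLT τ (tdeg p)) := by
  constructor
  · rw [Submodule.disjoint_def]
    rintro _ ⟨q, rfl⟩ h
    by_contra hne
    have hq : q ≠ 0 := by
      rintro rfl
      exact hne (map_zero _)
    exact coeff_mul_tdeg_add_ne_zero hq hp (h _ (Nat.le_add_left _ _))
  · have key : ∀ m, tdegLT τ m ≤ LinearMap.range (mulRight p) ⊔ tdegLT τ (tdeg p) := by
      intro m
      induction m with
      | zero =>
        intro q hq
        have : q = 0 := SkewPolynomial.ext fun i => hq i (Nat.zero_le i)
        rw [this]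
        exact zero_mem _
      | succ m ih =>
        intro q hq
        by_cases hm : m < tdeg p
        · exact le_sup_right (a := LinearMap.range (mulRight p)) fun i hi => hq i (by omega)
        have hlc := ofAdd_smul_ne_zero (m - tdeg p) (coeff_tdeg_ne_zero hp)
        -- Moving the coefficient past `τ ^ (m - deg p)` twists the leading coefficient of `p`,
        -- hence the inverse of the twisted one.
        let y : TwPoly τ := SkewPolynomial.monomial (m - tdeg p)
          (q.coeff m * (Multiplicative.ofAdd (m - tdeg p) • p.coeff (tdeg p))⁻¹)
        have h1 : q - y * p ∈ tdegLT τ m := by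
          intro i hi
          rw [SkewPolynomial.coeff_sub, TwPoly.coeff_monomial_mul, if_pos (by omega)]
          rcases eq_or_lt_of_le hi with rfl | hi
          · rw [Nat.sub_sub_self (not_lt.mp hm), mul_assoc, inv_mul_cancel₀ hlc, mul_one, sub_self]
          · rw [hq i hi, coeff_eq_zero_of_tdeg_lt (p := p) (m := i - (m - tdeg p)) (by omega), smul_zero, mul_zero,
              sub_zero]
        rw [← sub_add_cancel q (y * p)]
        exact add_mem (ih h1) (le_sup_left (b := tdegLT τ (tdeg p))
          (show y * p ∈ LinearMap.range (mulRight p) from ⟨y, rfl⟩))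
    rw [codisjoint_iff, eq_top_iff]
    rintro q -
    exact key (tdeg q + 1) fun i hi => coeff_eq_zero_of_tdeg_lt hi

lemma finite_quotient_mulRight {p : TwPoly τ} (hp : p ≠ 0) :
    Module.Finite (Twisted τ) (TwPoly τ ⧸ LinearMap.range (mulRight p)) :=
  have := finite_tdegLT (τ := τ) (tdeg p)
  Module.Finite.equiv (Submodule.quotientEquivOfIsCompl _ _ (isCompl_tdegLT_range hp)).symm

lemma finrank_quotient_mulRight {p : TwPoly τ} (hp : p ≠ 0) :
    Module.finrank (Twisted τ) (TwPoly τ ⧸ LinearMap.range (mulRight p)) = tdeg p := by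
  rw [(Submodule.quotientEquivOfIsCompl _ _ (isCompl_tdegLT_range hp)).finrank_eq, finrank_tdegLT]

lemma mulRight_injective {p : TwPoly τ} (hp : p ≠ 0) : Function.Injective (mulRight p) := by
  rw [injective_iff_map_eq_zero]
  intro q hq
  by_contra hne
  refine coeff_mul_tdeg_add_ne_zero hne hp ?_
  rw [show q * p = 0 from hq]
  rfl

variable {l : ℕ}

lemma rightMul_apply (B : Matrix (Fin l) (Fin l) (TwPoly τ)) (m : Fin l → TwPoly τ) :
    rightMul B m = Matrix.vecMul m B := rfl

lemma rightMul_diagonal_apply (D : Fin l → TwPoly τ) (m : Fin l → TwPoly τ) (i : Fin l) :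
    rightMul (Matrix.diagonal D) m i = mulRight (D i) (m i) := by
  rw [rightMul_apply, Matrix.vecMul_diagonal]
  rfl

lemma range_rightMul_diagonal (D : Fin l → TwPoly τ) :
    LinearMap.range (rightMul (Matrix.diagonal D)) =
      Submodule.pi Set.univ fun i => LinearMap.range (mulRight (D i)) := by
  ext m
  rw [LinearMap.mem_range, Submodule.mem_pi]
  constructor
  · rintro ⟨y, rfl⟩ i -
    exact ⟨y i, (rightMul_diagonal_apply D y i).symm⟩
  · intro h
    choose y hy using fun i => h i (Set.mem_univ i)
    exact ⟨y, funext fun i => by rw [rightMul_diagonal_apply, hy]⟩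

/-- The cokernel of right multiplication by a diagonal matrix. -/
def quotientDiagonalEquiv (D : Fin l → TwPoly τ) :
    ((Fin l → TwPoly τ) ⧸ LinearMap.range (rightMul (Matrix.diagonal D))) ≃ₗ[Twisted τ]
      ∀ i, TwPoly τ ⧸ LinearMap.range (mulRight (D i)) :=
  (Submodule.quotEquivOfEq _ _ (range_rightMul_diagonal D)).trans
    (Submodule.quotientPi fun i => LinearMap.range (mulRight (D i)))

lemma finrank_quotient_diagonal {D : Fin l → TwPoly τ} (hD : ∀ i, D i ≠ 0) :
    Module.finrank (Twisted τ)
      ((Fin l → TwPoly τ) ⧸ LinearMap.range (rightMul (Matrix.diagonal D))) = ∑ i, tdeg (D i) := by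
  have := fun i => finite_quotient_mulRight (hD i)
  rw [(quotientDiagonalEquiv D).finrank_eq, Module.finrank_pi_fintype]
  exact Finset.sum_congr rfl fun i _ => finrank_quotient_mulRight (hD i)

/-- A zero entry would contribute a full, infinite-dimensional copy of the twisted polynomials. -/
lemma ne_zero_of_finite_quotient_diagonal {D : Fin l → TwPoly τ}
    (h : Module.Finite (Twisted τ)
      ((Fin l → TwPoly τ) ⧸ LinearMap.range (rightMul (Matrix.diagonal D)))) (i : Fin l) :
    D i ≠ 0 := by
  intro hi
  have h1 : Module.Finite (Twisted τ) (∀ i, TwPoly τ ⧸ LinearMap.range (mulRight (D i))) :=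
    Module.Finite.equiv (quotientDiagonalEquiv D)
  have h2 := finite_pi_of_finite (F := Twisted τ)
    (fun i => TwPoly τ ⧸ LinearMap.range (mulRight (D i))) i
  have h3 : LinearMap.range (mulRight (D i)) = ⊥ := by
    rw [LinearMap.range_eq_bot]
    refine LinearMap.ext fun q => ?_
    change q * D i = 0
    rw [hi, mul_zero]
  exact not_finite_twPoly (Module.Finite.equiv (Submodule.quotEquivOfEqBot _ h3))

lemma rightMul_mul_apply (A B : Matrix (Fin l) (Fin l) (TwPoly τ)) (m : Fin l → TwPoly τ) :
    rightMul (A * B) m = rightMul B (rightMul A m) :=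
  (Matrix.vecMul_vecMul m A B).symm

/-- Right multiplication by an invertible matrix. -/
def rightMulUnit (V : (Matrix (Fin l) (Fin l) (TwPoly τ))ˣ) :
    (Fin l → TwPoly τ) ≃ₗ[Twisted τ] (Fin l → TwPoly τ) :=
  LinearEquiv.ofLinearMap (rightMul V) (rightMul ↑V⁻¹)
    (LinearMap.ext fun m => by
      rw [LinearMap.comp_apply, ← rightMul_mul_apply, Units.inv_mul]
      exact Matrix.vecMul_one m)
    (LinearMap.ext fun m => by
      rw [LinearMap.comp_apply, ← rightMul_mul_apply, Units.mul_inv]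
      exact Matrix.vecMul_one m)

/-- The degree of the diagonal form is the dimension of the cokernel of right multiplication. -/
lemma finrank_quotient_of_isDiagDegree {η : Matrix (Fin l) (Fin l) (TwPoly τ)} {s : ℕ}
    (h : AndersonModule.IsDiagDegree η s)
    [hfin : Module.Finite (Twisted τ) ((Fin l → TwPoly τ) ⧸ LinearMap.range (rightMul η))] :
    Module.finrank (Twisted τ) ((Fin l → TwPoly τ) ⧸ LinearMap.range (rightMul η)) = s := by
  obtain ⟨U, V, D, hD, rfl⟩ := h
  -- The invertible `U` does not change the range, and `V` carries the range of `η` onto that of the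
  -- diagonal matrix.
  have hmap : (LinearMap.range (rightMul η)).map ((rightMulUnit V : (Fin l → TwPoly τ)
      ≃ₗ[Twisted τ] (Fin l → TwPoly τ)) : (Fin l → TwPoly τ) →ₗ[Twisted τ] (Fin l → TwPoly τ)) =
      LinearMap.range (rightMul (Matrix.diagonal D)) := by
    rw [← hD, ← LinearMap.range_comp]
    ext m
    constructor
    · rintro ⟨y, rfl⟩
      refine ⟨(rightMulUnit U).symm y, ?_⟩
      rw [rightMul_mul_apply, rightMul_mul_apply]
      exact congrArg (fun z => rightMul (V : Matrix (Fin l) (Fin l) (TwPoly τ)) (rightMul η z))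
        ((rightMulUnit U).apply_symm_apply y)
    · rintro ⟨y, rfl⟩
      refine ⟨rightMul (U : Matrix (Fin l) (Fin l) (TwPoly τ)) y, ?_⟩
      rw [rightMul_mul_apply, rightMul_mul_apply]
      rfl
  let e := Submodule.Quotient.equiv _ _ (rightMulUnit V) hmap
  have := Module.Finite.equiv e
  rw [e.finrank_eq, finrank_quotient_diagonal (ne_zero_of_finite_quotient_diagonal this)]

lemma rightMul_pow_apply (B : Matrix (Fin l) (Fin l) (TwPoly τ)) (i : ℕ) (m : Fin l → TwPoly τ) :
    (rightMul B ^ i) m = rightMul (B ^ i) m := by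
  induction i generalizing m with
  | zero => exact (Matrix.vecMul_one m).symm
  | succ i ih => rw [pow_succ, Module.End.mul_apply, ih, pow_succ', rightMul_mul_apply]

/-- Scalars from `K` are central, and the reversal of products by right multiplication is harmless
among powers of one matrix. -/
lemma aeval_rightMul_map (B : Matrix (Fin l) (Fin l) (TwPoly τ)) (p : K[X]) (m : Fin l → TwPoly τ) :
    aeval (rightMul B) (p.map (algebraMap K (Twisted τ))) m = rightMul (aeval B p) m := by
  induction p using Polynomial.induction_on' with
  | add p q hp hq =>
    rw [Polynomial.map_add, map_add, map_add, LinearMap.add_apply, hp, hq]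
    exact (Matrix.vecMul_add _ _ m).symm
  | monomial i c =>
    rw [map_monomial, aeval_monomial, aeval_monomial, Module.End.mul_apply, rightMul_pow_apply,
      ← Algebra.smul_def, Module.algebraMap_end_apply, rightMul_apply, rightMul_apply,
      Matrix.vecMul_smul, algebraMap_smul]

end skew

lemma map_smul_polynomial {R R' M M' : Type*} [CommSemiring R] [CommSemiring R'] [AddCommMonoid M]
    [AddCommMonoid M'] [Module R[X] M] [Module R'[X] M'] (g : R →+* R') (f : M →+ M')
    (hC : ∀ (c : R) (m : M), f ((C c : R[X]) • m) = (C (g c) : R'[X]) • f m)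
    (hX : ∀ m : M, f ((X : R[X]) • m) = (X : R'[X]) • f m) (p : R[X]) (m : M) :
    f (p • m) = p.map g • f m := by
  induction p using Polynomial.induction_on generalizing m with
  | C c => rw [hC, map_C]
  | add p q hp hq => rw [add_smul, map_add, hp, hq, Polynomial.map_add, add_smul]
  | monomial i c ih =>
    rw [pow_succ, ← mul_assoc, mul_smul, ih, hX]
    conv_rhs => rw [Polynomial.map_mul, map_X, mul_smul]

/-- The cokernel of an endomorphism of `AEval' f`, over the coefficient field. -/
def quotientAEvalEquiv {F V : Type*} [Field F] [AddCommGroup V] [Module F V] (f : Module.End F V)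
    (G : Module.AEval' f →ₗ[F[X]] Module.AEval' f) (γ : V →ₗ[F] V)
    (h : ∀ v, G (Module.AEval'.of f v) = Module.AEval'.of f (γ v)) :
    (Module.AEval' f ⧸ LinearMap.range G) ≃ₗ[F] (V ⧸ LinearMap.range γ) :=
  (Submodule.Quotient.restrictScalarsEquiv F (LinearMap.range G)).symm.trans
    (Submodule.Quotient.equiv _ _ (Module.AEval'.of f).symm (by
      ext v
      constructor
      · rintro ⟨_, ⟨y, rfl⟩, rfl⟩
        refine ⟨(Module.AEval'.of f).symm y, ?_⟩
        apply (Module.AEval'.of f).injective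
        rw [← h, LinearEquiv.apply_symm_apply]
        exact ((Module.AEval'.of f).apply_symm_apply (G y)).symm
      · rintro ⟨y, rfl⟩
        refine ⟨G (Module.AEval'.of f y), ⟨_, rfl⟩, ?_⟩
        rw [h]
        exact (Module.AEval'.of f).symm_apply_apply _))

/-! ### The exact sequence 0 → H[σ] → H[σ] → H → 0 given by σ - 1. -/

section star

variable {K H : Type*} [Field K] [Field H] [Algebra K H]

lemma toAlgHom_pow_apply (τ : H ≃ₐ[K] H) (i : ℕ) (x : H) : (τ.toAlgHom ^ i) x = (τ ^ i) x := by
  induction i generalizing x with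
  | zero => rfl
  | succ i ih =>
    rw [pow_succ, pow_succ, AlgHom.mul_apply, ih]
    rfl

lemma pow_symm_pow_apply (τ : H ≃ₐ[K] H) (i : ℕ) (x : H) : (τ ^ i) ((τ.symm ^ i) x) = x := by
  change (τ ^ i * τ⁻¹ ^ i) x = x
  rw [inv_pow, mul_inv_cancel]
  rfl

variable (τ : H ≃ₐ[K] H)

lemma star_zero : star τ 0 = 0 := SkewPolynomial.sum_zero_index _

lemma star_add (p q : TwPoly τ.toAlgHom) : star τ (p + q) = star τ p + star τ q :=
  SkewPolynomial.sum_add_index p q _ (fun i => by simp) fun i a b => by simp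

lemma star_monomial (i : ℕ) (b : Twisted τ.toAlgHom) :
    star τ (SkewPolynomial.monomial i b) = SkewPolynomial.monomial i
      (toTw τ.symm.toAlgHom ((τ.symm ^ i) ((toTw τ.toAlgHom).symm b))) :=
  SkewPolynomial.sum_monomial_index (by simp)

/-- The map `∑ a_i σ^i ↦ ∑ τ^i(a_i)` from `H[σ]` to `H`, where `σ = τ^{-1}`. -/
def sumEv : TwPoly τ.symm.toAlgHom →+ H where
  toFun p := p.sum fun i a => (τ ^ i) ((toTw τ.symm.toAlgHom).symm a)
  map_zero' := SkewPolynomial.sum_zero_index _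
  map_add' p q := SkewPolynomial.sum_add_index p q _ (fun i => by simp) fun i a b => by simp

lemma sumEv_monomial (i : ℕ) (a : Twisted τ.symm.toAlgHom) :
    sumEv τ (SkewPolynomial.monomial i a) = (τ ^ i) ((toTw τ.symm.toAlgHom).symm a) := by
  change (SkewPolynomial.monomial i a).sum
    (fun i a => (τ ^ i) ((toTw τ.symm.toAlgHom).symm a)) = _
  exact SkewPolynomial.sum_monomial_index (by simp)

/-- Additive statements about twisted polynomials may be checked on monomials. -/
lemma TwPoly.induction_monomial {τ : H →ₐ[K] H} {motive : TwPoly τ → Prop} (p : TwPoly τ)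
    (h0 : motive 0) (hadd : ∀ p q, motive p → motive q → motive (p + q))
    (hm : ∀ i a, motive (SkewPolynomial.monomial i a)) : motive p :=
  SkewPolynomial.induction (motive := motive) p h0 fun i b _ _ _ ih => hadd _ _ (hm i b) ih

lemma ofAdd_smul_eq (i : ℕ) (x : Twisted τ.symm.toAlgHom) :
    Multiplicative.ofAdd i • x =
      toTw τ.symm.toAlgHom ((τ.symm ^ i) ((toTw τ.symm.toAlgHom).symm x)) := by
  rw [smul_tw, ← toAlgHom_pow_apply]
  rfl

/-- On monomials, (u σ^a)(σ^i(b) σ^i) = u σ^(a+i)(b) σ^(a+i), and τ^(a+i) sends this coefficient to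
b τ^i(τ^a(u)). -/
lemma sumEv_mul_star (p : TwPoly τ.symm.toAlgHom) (b : TwPoly τ.toAlgHom) :
    sumEv τ (p * star τ b) = ev τ.toAlgHom b (sumEv τ p) := by
  induction p using TwPoly.induction_monomial with
  | h0 => rw [zero_mul, map_zero, map_zero]
  | hadd p q hp hq => rw [add_mul, map_add, map_add, map_add, hp, hq]
  | hm a u =>
    induction b using TwPoly.induction_monomial with
    | h0 => rw [star_zero, mul_zero, map_zero, map_zero, LinearMap.zero_apply]
    | hadd p q hp hq => rw [star_add, mul_add, map_add, map_add, LinearMap.add_apply, hp, hq]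
    | hm i b =>
      rw [star_monomial, TwPoly.monomial_mul_monomial, sumEv_monomial, sumEv_monomial, ev_monomial,
        toAlgHom_pow_apply, ofAdd_smul_eq]
      simp only [map_mul, AlgEquiv.symm_apply_apply]
      have h1 : ∀ (x : H), (τ ^ (a + i)) x = (τ ^ i) ((τ ^ a) x) := fun x => by
        rw [add_comm, pow_add]; rfl
      rw [h1, h1, pow_symm_pow_apply, pow_symm_pow_apply, mul_comm]

/-- Right multiplication by σ^d raises exponents without touching coefficients. -/
lemma sumEv_mul_X_pow (p : TwPoly τ.symm.toAlgHom) (d : ℕ) :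
    sumEv τ (p * SkewPolynomial.X ^ d) = (τ ^ d) (sumEv τ p) := by
  induction p using TwPoly.induction_monomial with
  | h0 => rw [zero_mul, map_zero, map_zero]
  | hadd p q hp hq => rw [add_mul, map_add, map_add, map_add, hp, hq]
  | hm a u =>
    rw [SkewPolynomial.monomial_mul_X_pow, sumEv_monomial, sumEv_monomial, add_comm, pow_add]
    rfl

lemma sumEv_smul (c : K) (p : TwPoly τ.symm.toAlgHom) :
    sumEv τ (algebraMap K (Twisted τ.symm.toAlgHom) c • p) = c • sumEv τ p := by
  induction p using TwPoly.induction_monomial with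
  | h0 => rw [smul_zero, map_zero, smul_zero]
  | hadd p q hp hq => rw [smul_add, map_add, map_add, smul_add, hp, hq]
  | hm a u =>
    rw [SkewPolynomial.smul_monomial, sumEv_monomial, sumEv_monomial, algebraMap_smul, map_smul,
      map_smul]

lemma sumEv_X_mul (p : TwPoly τ.symm.toAlgHom) :
    sumEv τ (SkewPolynomial.X * p) = sumEv τ p := by
  induction p using TwPoly.induction_monomial with
  | h0 => rw [mul_zero]
  | hadd p q hp hq => rw [mul_add, map_add, map_add, hp, hq]
  | hm a u =>
    rw [← SkewPolynomial.monomial_one_one_eq_X, TwPoly.monomial_mul_monomial, sumEv_monomial,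
      sumEv_monomial, one_mul, ofAdd_smul_eq, AlgEquiv.symm_apply_apply, add_comm, pow_add]
    change (τ ^ a) ((τ ^ 1) ((τ.symm ^ 1) _)) = _
    rw [pow_symm_pow_apply]

/-- Because σ τ(u) = u σ, the monomial u σ^(a+1) is congruent to τ(u) σ^a modulo the image of σ - 1.
Iterating reduces everything to constants. -/
lemma exists_X_mul_sub_eq (p : TwPoly τ.symm.toAlgHom) :
    ∃ y, SkewPolynomial.X * y - y = p - SkewPolynomial.monomial 0 (toTw _ (sumEv τ p)) := by
  induction p using TwPoly.induction_monomial with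
  | h0 => exact ⟨0, by simp⟩
  | hadd p q hp hq =>
    obtain ⟨y, hy⟩ := hp
    obtain ⟨z, hz⟩ := hq
    refine ⟨y + z, ?_⟩
    rw [mul_add, add_sub_add_comm, hy, hz, map_add, map_add, map_add]
    abel
  | hm a u =>
    induction a generalizing u with
    | zero =>
      refine ⟨0, ?_⟩
      rw [sumEv_monomial, mul_zero, sub_zero, eq_comm, sub_eq_zero]
      rfl
    | succ a ih =>
      obtain ⟨y, hy⟩ := ih (toTw _ (τ ((toTw τ.symm.toAlgHom).symm u)))
      refine ⟨y + SkewPolynomial.monomial a (toTw _ (τ ((toTw τ.symm.toAlgHom).symm u))), ?_⟩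
      have h1 : (SkewPolynomial.X : TwPoly τ.symm.toAlgHom) *
          SkewPolynomial.monomial a (toTw _ (τ ((toTw τ.symm.toAlgHom).symm u))) =
          SkewPolynomial.monomial (a + 1) u := by
        rw [← SkewPolynomial.monomial_one_one_eq_X, TwPoly.monomial_mul_monomial, one_mul,
          ofAdd_smul_eq, AlgEquiv.symm_apply_apply, add_comm]
        congr 1
        exact τ.symm_apply_apply _
      have h2 : sumEv τ (SkewPolynomial.monomial a (toTw _ (τ ((toTw τ.symm.toAlgHom).symm u)))) =
          sumEv τ (SkewPolynomial.monomial (a + 1) u) := by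
        rw [← h1, sumEv_X_mul]
      rw [mul_add, add_sub_add_comm, hy, h1, h2]
      abel

lemma sumEv_eq_zero_iff (p : TwPoly τ.symm.toAlgHom) :
    sumEv τ p = 0 ↔ ∃ y, SkewPolynomial.X * y - y = p := by
  constructor
  · intro h
    obtain ⟨y, hy⟩ := exists_X_mul_sub_eq τ p
    rw [h, map_zero, map_zero, sub_zero] at hy
    exact ⟨y, hy⟩
  · rintro ⟨y, rfl⟩
    rw [map_sub, sumEv_X_mul, sub_self]

lemma sumEv_surjective : Function.Surjective (sumEv τ) := fun x =>
  ⟨SkewPolynomial.monomial 0 (toTw _ x), by rw [sumEv_monomial]; rfl⟩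

variable {τ}

/-- Left multiplication by `X` raises degrees, so the coefficients vanish one after another from the
constant term on. -/
lemma TwPoly.eq_zero_of_X_mul_eq {τ : H →ₐ[K] H} {p : TwPoly τ} (h : SkewPolynomial.X * p = p) :
    p = 0 := by
  refine SkewPolynomial.ext fun i => ?_
  induction i with
  | zero =>
    rw [← h, ← SkewPolynomial.monomial_one_one_eq_X, TwPoly.coeff_monomial_mul, if_neg (by omega)]
    rfl
  | succ i ih =>
    rw [← h, ← SkewPolynomial.monomial_one_one_eq_X, TwPoly.coeff_monomial_mul, if_pos (by omega),
      Nat.add_sub_cancel, ih, SkewPolynomial.coeff_zero, smul_zero, mul_zero]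
    rfl

lemma TwPoly.X_mul_smul {τ : H →ₐ[K] H} (c : Twisted τ) (p : TwPoly τ) :
    SkewPolynomial.X * (c • p) = SkewPolynomial.φ c • (SkewPolynomial.X * p) := by
  refine SkewPolynomial.ext fun i => ?_
  rw [TwPoly.coeff_smul, ← SkewPolynomial.monomial_one_one_eq_X, TwPoly.coeff_monomial_mul,
    TwPoly.coeff_monomial_mul]
  split_ifs
  · rw [TwPoly.coeff_smul, smul_mul', one_mul, one_mul]
    rfl
  · rw [mul_zero]

end star

/-! ### Points and motives of an Anderson module. -/

namespace AndersonModule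

section points

variable {K H : Type*} [Field K] [Field H] [Algebra K H] {τ : H →ₐ[K] H} {θ : H} {l : ℕ}
  (E : AndersonModule τ θ l)

instance : Module K E.Points := inferInstanceAs (Module K (Fin l → H))

instance : IsScalarTower K K[X] E.Points :=
  ⟨fun c a x => by
    rw [smul_points, smul_points, map_smul, map_smul]
    rfl⟩

lemma aeval_toAlgHom_X (p : K[X]) : aeval (E.toAlgHom X) p = E.toAlgHom p := by
  rw [aeval_algHom_apply, aeval_X_left_apply]

/-- The kernel of `E_a` has the same dimension as the `a`-torsion of the points. -/
def kernelEquiv (a : K[X]) :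
    kernel (E.toAlgHom a) ≃ₗ[K] LinearMap.ker (LinearMap.lsmul K[X] E.Points a) where
  toFun x := ⟨x.1, x.2⟩
  invFun x := ⟨x.1, x.2⟩
  map_add' _ _ := rfl
  map_smul' _ _ := rfl
  left_inv _ := rfl
  right_inv _ := rfl

/-- Both sides are the dimension of the `t`-motive modulo `p`: once from the diagonal form of `E_p`,
once from freeness over the polynomial ring. -/
lemma finrank_motive_quotient {r s : ℕ} (ha : E.IsAbelian r) {p : K[X]} (hp : p ≠ 0)
    (hs : IsDiagDegree (E.toAlgHom p) s) : s = r * p.natDegree := by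
  obtain ⟨_, _, hr⟩ := ha
  let q : (Twisted τ)[X] := p.map (algebraMap K (Twisted τ))
  have hq : q ≠ 0 := Polynomial.map_ne_zero hp
  let e := quotientAEvalEquiv (rightMul (E.toAlgHom X)) (LinearMap.lsmul _ E.Motive q)
    (rightMul (E.toAlgHom p)) (fun v => by
      rw [← E.aeval_toAlgHom_X p, ← aeval_rightMul_map]
      rfl)
  have := finite_quotient_range (F := Twisted τ) (lsmul_injective_of_ne_zero (N := E.Motive) hq)
  have hfin := Module.Finite.equiv e
  rw [← finrank_quotient_of_isDiagDegree hs, ← e.finrank_eq, finrank_quotient_lsmul hq, hr,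
    natDegree_map]

end points

section dual

variable {K H : Type*} [Field K] [Field H] [Algebra K H] {τ : H ≃ₐ[K] H} {θ : H} {l : ℕ}
  (E : AndersonModule τ.toAlgHom θ l)

/-- The identification of the dual `t`-motive with row vectors. -/
abbrev dualOf : (Fin l → TwPoly τ.symm.toAlgHom) ≃ₗ[Twisted τ.symm.toAlgHom] E.DualMotive :=
  Module.AEval'.of (rightMul (matStar τ (E.toAlgHom X)))

lemma X_smul_dualOf (m : Fin l → TwPoly τ.symm.toAlgHom) :
    (X : (Twisted τ.symm.toAlgHom)[X]) • E.dualOf m =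
      E.dualOf (rightMul (matStar τ (E.toAlgHom X)) m) :=
  Module.AEval'.X_smul_of _ _

/-- An additive map on row vectors induces an additive map on the dual `t`-motive. -/
def dualMap (f : TwPoly τ.symm.toAlgHom →+ TwPoly τ.symm.toAlgHom) :
    E.DualMotive →+ E.DualMotive :=
  (E.dualOf : (Fin l → TwPoly τ.symm.toAlgHom) →+ E.DualMotive).comp
    ((AddMonoidHom.compLeft f (Fin l)).comp (E.dualOf.symm : E.DualMotive →+ _))

lemma dualMap_dualOf (f : TwPoly τ.symm.toAlgHom →+ TwPoly τ.symm.toAlgHom)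
    (m : Fin l → TwPoly τ.symm.toAlgHom) :
    E.dualMap f (E.dualOf m) = E.dualOf fun i => f (m i) := by
  change E.dualOf (fun i => f (E.dualOf.symm (E.dualOf m) i)) = _
  rw [LinearEquiv.symm_apply_apply]

lemma dualMap_X_smul (f : TwPoly τ.symm.toAlgHom →+ TwPoly τ.symm.toAlgHom)
    (hf : ∀ p i j, f (p * star τ (E.toAlgHom X i j)) = f p * star τ (E.toAlgHom X i j))
    (n : E.DualMotive) :
    E.dualMap f ((X : (Twisted τ.symm.toAlgHom)[X]) • n) =
      (X : (Twisted τ.symm.toAlgHom)[X]) • E.dualMap f n := by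
  obtain ⟨m, rfl⟩ := E.dualOf.surjective n
  rw [X_smul_dualOf, dualMap_dualOf, dualMap_dualOf, X_smul_dualOf]
  congr 1
  funext j
  change f (∑ i, m i * star τ (E.toAlgHom X j i)) = ∑ i, f (m i) * star τ (E.toAlgHom X j i)
  rw [map_sum]
  exact Finset.sum_congr rfl fun i _ => hf _ _ _

lemma dualMap_C_smul {g : Twisted τ.symm.toAlgHom →+* Twisted τ.symm.toAlgHom}
    (f : TwPoly τ.symm.toAlgHom →+ TwPoly τ.symm.toAlgHom)
    (hf : ∀ c p, f (c • p) = g c • f p) (c : Twisted τ.symm.toAlgHom) (n : E.DualMotive) :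
    E.dualMap f ((C c : (Twisted τ.symm.toAlgHom)[X]) • n) =
      (C (g c) : (Twisted τ.symm.toAlgHom)[X]) • E.dualMap f n := by
  obtain ⟨m, rfl⟩ := E.dualOf.surjective n
  rw [C_smul, C_smul, ← map_smul, dualMap_dualOf, dualMap_dualOf, ← map_smul]
  congr 1
  funext i
  exact hf _ _

/-- The map from the dual `t`-motive to the points of `E` induced by `∑ a_i σ^i ↦ ∑ τ^i(a_i)`. -/
def dualEv : E.DualMotive →+ E.Points :=
  (AddMonoidHom.compLeft (sumEv τ) (Fin l)).comp (E.dualOf.symm : E.DualMotive →+ _)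

lemma dualEv_dualOf (m : Fin l → TwPoly τ.symm.toAlgHom) :
    E.dualEv (E.dualOf m) = fun i => sumEv τ (m i) := by
  change (fun i => sumEv τ (E.dualOf.symm (E.dualOf m) i)) = _
  rw [LinearEquiv.symm_apply_apply]

lemma dualEv_smul (p : K[X]) (n : E.DualMotive) :
    E.dualEv (p.map (algebraMap K (Twisted τ.symm.toAlgHom)) • n) = p • E.dualEv n := by
  -- Restricting scalars to `K[X]` allows linearity to be tested on constants and `X`, with the
  -- identity as coefficient map.
  let : Module K[X] E.DualMotive :=
    Module.compHom _ (mapRingHom (algebraMap K (Twisted τ.symm.toAlgHom)))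
  have h : ∀ (a : K[X]) (n : E.DualMotive),
      a • n = a.map (algebraMap K (Twisted τ.symm.toAlgHom)) • n := fun _ _ => rfl
  have key := map_smul_polynomial (RingHom.id K) E.dualEv (fun c n => ?_) (fun n => ?_) p n
  · rwa [h, Polynomial.map_id] at key
  · obtain ⟨m, rfl⟩ := E.dualOf.surjective n
    rw [h, map_C, C_smul, C_smul, ← map_smul, dualEv_dualOf, dualEv_dualOf]
    exact funext fun i => sumEv_smul τ c (m i)
  · obtain ⟨m, rfl⟩ := E.dualOf.surjective n
    rw [h, map_X, X_smul_dualOf, dualEv_dualOf, dualEv_dualOf]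
    funext j
    change sumEv τ (∑ i, m i * star τ (E.toAlgHom X j i)) =
      ∑ i, ev τ.toAlgHom (E.toAlgHom X j i) (sumEv τ (m i))
    rw [map_sum]
    exact Finset.sum_congr rfl fun i _ => sumEv_mul_star τ _ _

/-- The points of `E` are the cokernel of `σ - 1` on the dual `t`-motive. -/
def presentation : SemilinearPresentation (K := K)
    (SkewPolynomial.φ : Twisted τ.symm.toAlgHom →+* Twisted τ.symm.toAlgHom)
    E.DualMotive E.Points where
  S :=
    { E.dualMap (AddMonoidHom.mulLeft SkewPolynomial.X) with
      map_smul' := map_smul_polynomial SkewPolynomial.φ _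
        (E.dualMap_C_smul _ TwPoly.X_mul_smul)
        (E.dualMap_X_smul _ fun p i j => (mul_assoc _ _ _).symm) }
  ε := E.dualEv
  ε_smul := E.dualEv_smul
  surjective x := by
    choose m hm using fun i => sumEv_surjective τ (x i)
    exact ⟨E.dualOf m, funext hm⟩
  ker n := by
    obtain ⟨m, rfl⟩ := E.dualOf.surjective n
    constructor
    · intro h
      choose y hy using fun i => (sumEv_eq_zero_iff τ (m i)).mp (congrFun h i)
      refine ⟨E.dualOf y, ?_⟩
      change E.dualMap _ _ - _ = _
      rw [dualMap_dualOf, ← map_sub]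
      exact congrArg E.dualOf (funext hy)
    · rintro ⟨y, hy⟩
      obtain ⟨y, rfl⟩ := E.dualOf.surjective y
      change E.dualMap _ _ - _ = _ at hy
      rw [dualMap_dualOf, ← map_sub] at hy
      have := E.dualOf.injective hy
      exact funext fun i => (sumEv_eq_zero_iff τ (m i)).mpr ⟨y i, congrFun this i⟩
  injective n h := by
    obtain ⟨m, rfl⟩ := E.dualOf.surjective n
    change E.dualMap _ _ = _ at h
    rw [dualMap_dualOf] at h
    have := E.dualOf.injective h
    rw [show m = 0 from funext fun i => TwPoly.eq_zero_of_X_mul_eq (congrFun this i), map_zero]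

variable {d : ℕ}
  (hd : ∀ i j, SkewPolynomial.X ^ d * star τ (E.toAlgHom X i j) =
    star τ (E.toAlgHom X i j) * SkewPolynomial.X ^ d)

/-- Right multiplication by `σ^d`, if it commutes with `E_t^*`. -/
def mulXPow : E.DualMotive →ₗ[(Twisted τ.symm.toAlgHom)[X]] E.DualMotive where
  toFun := E.dualMap (AddMonoidHom.mulRight (SkewPolynomial.X ^ d))
  map_add' := map_add _
  map_smul' p n := by
    have := map_smul_polynomial (RingHom.id _) (E.dualMap (AddMonoidHom.mulRight
      (SkewPolynomial.X ^ d))) (E.dualMap_C_smul _ fun c p => smul_mul_assoc c p _)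
      (E.dualMap_X_smul _ fun p i j => by
        change p * _ * _ = p * _ * _
        rw [mul_assoc, mul_assoc, hd]) p n
    rwa [Polynomial.map_id] at this

lemma mulXPow_dualOf (m : Fin l → TwPoly τ.symm.toAlgHom) :
    E.mulXPow hd (E.dualOf m) = E.dualOf fun i => m i * SkewPolynomial.X ^ d :=
  E.dualMap_dualOf _ _

lemma mulXPow_presentation_S (n : E.DualMotive) :
    E.mulXPow hd (E.presentation.S n) = E.presentation.S (E.mulXPow hd n) := by
  obtain ⟨m, rfl⟩ := E.dualOf.surjective n
  change E.mulXPow hd (E.dualMap _ _) = E.dualMap _ _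
  rw [dualMap_dualOf, mulXPow_dualOf, mulXPow_dualOf, dualMap_dualOf]
  exact congrArg E.dualOf (funext fun i => mul_assoc _ _ _)

lemma presentation_ε_mulXPow (n : E.DualMotive) :
    E.presentation.ε (E.mulXPow hd n) = fun i => (τ.toAlgHom ^ d) (E.presentation.ε n i) := by
  obtain ⟨m, rfl⟩ := E.dualOf.surjective n
  change E.dualEv _ = fun i => (τ.toAlgHom ^ d) (E.dualEv _ i)
  rw [mulXPow_dualOf, dualEv_dualOf, dualEv_dualOf]
  exact funext fun i => by rw [sumEv_mul_X_pow, toAlgHom_pow_apply]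

/-- The leading coefficient is `-1`; for `d = 0` the difference would vanish. -/
lemma tdeg_one_sub_X_pow {τ : H →ₐ[K] H} (hd0 : 0 < d) :
    tdeg (1 - SkewPolynomial.X ^ d : TwPoly τ) = d ∧ (1 - SkewPolynomial.X ^ d : TwPoly τ) ≠ 0 := by
  have h1 : ∀ i, (1 - SkewPolynomial.X ^ d : TwPoly τ).coeff i =
      (if i = 0 then 1 else 0) - if d = i then 1 else 0 := fun i => by
    rw [SkewPolynomial.coeff_sub, ← SkewPolynomial.monomial_one_right_eq_X_pow,
      SkewPolynomial.coeff_monomial, ← SkewPolynomial.monomial_zero_one,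
      SkewPolynomial.coeff_monomial]
    simp only [eq_comm]
  have h2 : (1 - SkewPolynomial.X ^ d : TwPoly τ).coeff d ≠ 0 := by
    rw [h1, if_neg hd0.ne', if_pos rfl, zero_sub]
    exact neg_ne_zero.mpr one_ne_zero
  refine ⟨tdeg_eq_of_coeff h2 fun i hi => ?_, fun h => h2 (by rw [h]; rfl)⟩
  rw [h1, if_neg (by omega), if_neg (by omega), sub_zero]

lemma one_sub_mulXPow_dualOf (m : Fin l → TwPoly τ.symm.toAlgHom) :
    (1 - E.mulXPow hd : E.DualMotive →ₗ[(Twisted τ.symm.toAlgHom)[X]] E.DualMotive) (E.dualOf m) =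
      E.dualOf (rightMul (Matrix.diagonal fun _ => 1 - SkewPolynomial.X ^ d) m) := by
  rw [LinearMap.sub_apply, mulXPow_dualOf]
  change E.dualOf m - _ = _
  rw [← map_sub]
  congr 1
  funext i
  rw [rightMul_diagonal_apply]
  change m i - _ = m i * (1 - _)
  rw [mul_sub, mul_one]

lemma one_sub_mulXPow_injective (hd0 : 0 < d) : Function.Injective
    (1 - E.mulXPow hd : E.DualMotive →ₗ[(Twisted τ.symm.toAlgHom)[X]] E.DualMotive) := by
  intro x y h
  obtain ⟨x, rfl⟩ := E.dualOf.surjective x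
  obtain ⟨y, rfl⟩ := E.dualOf.surjective y
  rw [one_sub_mulXPow_dualOf, one_sub_mulXPow_dualOf] at h
  have h1 := E.dualOf.injective h
  congr 1
  funext i
  have h2 := congrFun h1 i
  rw [rightMul_diagonal_apply, rightMul_diagonal_apply] at h2
  exact mulRight_injective (tdeg_one_sub_X_pow hd0).2 h2

/-- The map is right multiplication by a diagonal matrix with `l` entries 1 - σ^d, each of degree
`d`. -/
lemma finrank_quotient_one_sub_mulXPow (hd0 : 0 < d) :
    Module.finrank (Twisted τ.symm.toAlgHom) (E.DualMotive ⧸ LinearMap.range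
      (1 - E.mulXPow hd : E.DualMotive →ₗ[(Twisted τ.symm.toAlgHom)[X]] E.DualMotive)) = l * d := by
  rw [(quotientAEvalEquiv _ _ _ (E.one_sub_mulXPow_dualOf hd)).finrank_eq,
    finrank_quotient_diagonal fun _ => (tdeg_one_sub_X_pow hd0).2,
    Finset.sum_congr rfl fun _ _ => (tdeg_one_sub_X_pow hd0).1]
  simp

end dual

end AndersonModule

/-! ### Extension of coefficients and commutation with σ^d. -/

section baseChange

variable {K H H' : Type*} [Field K] [Field H] [Field H'] [Algebra K H] [Algebra K H']

lemma ev_map {τ : H →ₐ[K] H} {τ' : H' →ₐ[K] H'} (g : H →ₐ[K] H')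
    (hg : ∀ x, g (τ x) = τ' (g x)) (p : TwPoly τ) (x : H) :
    ev τ' (TwPoly.map g hg p) (g x) = g (ev τ p x) := by
  induction p using TwPoly.induction_monomial with
  | h0 => simp only [map_zero, LinearMap.zero_apply]
  | hadd p q hp hq => simp only [map_add, LinearMap.add_apply, hp, hq]
  | hm i a =>
    rw [TwPoly.map_monomial, ev_monomial, ev_monomial, map_mul, map_pow_comm g hg,
      AlgEquiv.symm_apply_apply]

namespace AndersonModule

/-- The map `E(H) → E(H')` induced by an extension of coefficients. -/
def pointsMap {τ : H →ₐ[K] H} {θ : H} {l : ℕ} (E : AndersonModule τ θ l) {τ' : H' →ₐ[K] H'}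
    (g : H →ₐ[K] H') (hg : ∀ x, g (τ x) = τ' (g x)) :
    E.Points →ₗ[K[X]] (E.baseChange g hg).Points where
  toFun x i := g (x i)
  map_add' x y := funext fun i => map_add g (x i) (y i)
  map_smul' a x := by
    funext i
    change g (∑ j, ev τ (E.toAlgHom a i j) (x j)) =
      ∑ j, ev τ' (TwPoly.map g hg (E.toAlgHom a i j)) (g (x j))
    rw [map_sum]
    exact Finset.sum_congr rfl fun j _ => (ev_map g hg _ _).symm

end AndersonModule

/-- Coefficients coming from `H` are fixed by `τ'^d`, so σ^d commutes with them; this makes right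
multiplication by σ^d linear on the dual motive. -/
lemma X_pow_mul_star_map {τ : H →ₐ[K] H} {τ' : H' ≃ₐ[K] H'} (g : H →ₐ[K] H')
    (hg : ∀ x, g (τ x) = τ'.toAlgHom (g x)) {d : ℕ} (hd : ∀ x, (τ ^ d) x = x) (p : TwPoly τ) :
    SkewPolynomial.X ^ d * star τ' (TwPoly.map g hg p) =
      star τ' (TwPoly.map g hg p) * SkewPolynomial.X ^ d := by
  induction p using TwPoly.induction_monomial with
  | h0 => rw [map_zero, star_zero, mul_zero, zero_mul]
  | hadd p q hp hq => rw [map_add, star_add, mul_add, add_mul, hp, hq]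
  | hm i a =>
    have h1 : ∀ x : H, (τ'.symm ^ d) (g x) = g x := fun x => by
      apply (τ' ^ d).injective
      rw [pow_symm_pow_apply, ← toAlgHom_pow_apply, ← map_pow_comm g hg, hd]
    have h2 : ∀ x : H', (τ'.symm ^ d) ((τ'.symm ^ i) x) = (τ'.symm ^ i) ((τ'.symm ^ d) x) :=
      fun x => by rw [← AlgEquiv.mul_apply, ← AlgEquiv.mul_apply, ← pow_add, ← pow_add, add_comm]
    rw [TwPoly.map_monomial, star_monomial, SkewPolynomial.monomial_mul_X_pow,
      ← SkewPolynomial.monomial_one_right_eq_X_pow, TwPoly.monomial_mul_monomial, one_mul,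
      ofAdd_smul_eq, AlgEquiv.symm_apply_apply, AlgEquiv.symm_apply_apply, h2, h1, add_comm]

end baseChange

/-- `γ` has to be the inverse of the leading coefficient, and a monic polynomial associated to the
monic `Q` is `Q`. -/
lemma isOrder_C_mul {F M : Type*} [Field F] [AddCommGroup M] [Module F[X] M] {P Q : F[X]}
    (hPQ : Associated P Q) (hQ : Q.Monic) (hM : IsOrder M Q) :
    (∃! γ : Fˣ, (C (γ : F) * P).Monic) ∧
      ∀ γ : Fˣ, (C (γ : F) * P).Monic → IsOrder M (C (γ : F) * P) := by
  have hP : P ≠ 0 := fun h => hQ.ne_zero (hPQ.eq_zero_iff.mp h)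
  have hiff : ∀ γ : Fˣ, (C (γ : F) * P).Monic ↔ (γ : F) * P.leadingCoeff = 1 := fun γ => by
    rw [Monic, leadingCoeff_mul, leadingCoeff_C]
  refine ⟨⟨(Units.mk0 _ (leadingCoeff_ne_zero.mpr hP))⁻¹, ?_, fun γ hγ => ?_⟩, fun γ hγ => ?_⟩
  · refine (hiff _).mpr ?_
    rw [Units.val_inv_eq_inv_val, Units.val_mk0, inv_mul_cancel₀ (leadingCoeff_ne_zero.mpr hP)]
  · rw [eq_inv_iff_mul_eq_one]
    exact Units.ext ((hiff γ).mp hγ)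
  · rwa [eq_of_monic_of_associated hγ hQ
      ((associated_isUnit_mul_left_iff (isUnit_C.mpr γ.isUnit)).mpr hPQ)]

/-! ### The fixed field of τ and independent points over 𝔽_f{Z}. -/

section finchar

variable {Fq : Type*} [Field Fq] (f : Fq[X]) [Fact (Irreducible f)] (k : Kind) (n : ℕ)

lemma taubar_symm_eq_self_iff [Fintype Fq] (c : ZField k n (Fbar f)) :
    (taubar f k n).symm c = c ↔ ∃ a : ZField k n Fq, algebraMap _ (ZField k n (Fbar f)) a = c := by
  constructor
  · intro h
    refine ZField.exists_algebraMap_eq_of_fixed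
      (FiniteField.frobeniusAlgEquivOfAlgebraic Fq (Fbar f))
      (fun c hc => exists_algebraMap_eq_of_pow_card c ?_) c ?_
    · rwa [FiniteField.coe_frobeniusAlgEquivOfAlgebraic] at hc
    · conv_lhs => rw [← h]
      exact (taubar f k n).apply_symm_apply c
  · rintro ⟨a, rfl⟩
    exact AlgEquiv.commutes _ a

/-- Constants of `𝔽_f` spread over the coordinates of `𝔽_f{Z}^l`. -/
lemma linearIndependent_single_const (l : ℕ) : LinearIndependent (ZField k n Fq)
    (fun x : Σ _ : Fin l, Fin f.natDegree => (Pi.single x.1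
      (ZField.const k n (Ff f) (AdjoinRoot.root f ^ (x.2 : ℕ))) : Fin l → ZField k n (Ff f))) := by
  refine Pi.linearIndependent_single
    (fun (_ : Fin l) (j : Fin f.natDegree) =>
      ZField.const k n (Ff f) (AdjoinRoot.root f ^ (j : ℕ))) fun _ => ?_
  let pb := AdjoinRoot.powerBasis (Fact.out (p := Irreducible f)).ne_zero
  have h1 := ZField.linearIndependent_const (k := k) (n := n) pb.basis.linearIndependent
  have h2 : (fun i => ZField.const k n (Ff f) (pb.basis i)) =
      fun i : Fin pb.dim => ZField.const k n (Ff f) (AdjoinRoot.root f ^ (i : ℕ)) :=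
    funext fun i => by rw [pb.basis_eq_pow]; rfl
  rw [h2] at h1
  exact h1

end finchar

end AndersonT

end

/-! ### The theorem. -/

open AndersonT in
theorem theorem3 {Fq : Type*} [Field Fq] [Fintype Fq] (k : AndersonT.Kind) (n : ℕ)
    (f : Polynomial Fq) [Fact (Irreducible f)] (hf : f.Monic)
    (θbar : AndersonT.Ff f) (hθ : Polynomial.aeval θbar f = 0) (l : ℕ)
    (E : AndersonT.AndersonModule (AndersonT.tauf f k n)
      (AndersonT.ZField.const k n (AndersonT.Ff f) θbar) l)
    (lam : Polynomial Fq) (hlam : lam.Monic) (hirr : Irreducible lam) (hne : lam ≠ f) (r : ℕ)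
    (ha : E.bar.IsAbelian r) (hb : E.bar.IsTFinite r)
    (hc : ∀ m : ℕ, 1 ≤ m → E.bar.TorsionFull (AndersonT.constPoly k n lam ^ m)) :
    ∃ (_ : Module.Free (AndersonT.Compl (AndersonT.constPoly k n lam))
          (AndersonT.TateModule (AndersonT.constPoly k n lam) E.bar.Points))
      (_ : Module.Finite (AndersonT.Compl (AndersonT.constPoly k n lam))
          (AndersonT.TateModule (AndersonT.constPoly k n lam) E.bar.Points)),
      Module.finrank (AndersonT.Compl (AndersonT.constPoly k n lam))
          (AndersonT.TateModule (AndersonT.constPoly k n lam) E.bar.Points) = r ∧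
      ∃ P : Polynomial (AndersonT.ZField k n Fq),
        algebraMap (Polynomial (AndersonT.ZField k n Fq))
            (AndersonT.Compl (AndersonT.constPoly k n lam)) P =
          (AndersonT.TateModule.map (p := AndersonT.constPoly k n lam) E.tauPow).charpoly.eval 1 ∧
        (∃! γ : (AndersonT.ZField k n Fq)ˣ,
          (Polynomial.C (γ : AndersonT.ZField k n Fq) * P).Monic) ∧
        ∀ γ : (AndersonT.ZField k n Fq)ˣ,
          (Polynomial.C (γ : AndersonT.ZField k n Fq) * P).Monic →
          AndersonT.IsOrder E.Points (Polynomial.C (γ : AndersonT.ZField k n Fq) * P) := by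
  have hp : (constPoly k n lam).Monic := hlam.map _
  have hd0 : 0 < f.natDegree := (Fact.out (p := Irreducible f)).natDegree_pos
  have hd := fun i j => X_pow_mul_star_map (incl f k n) (incl_tauf f k n) (tauf_pow f k n)
    (E.toAlgHom X i j)
  -- Full dimension equates the dimension of the torsion with the degree of the diagonal form, and
  -- the `t`-motive evaluates that degree.
  have hrank : ∀ m, 1 ≤ m → Module.rank (ZField k n Fq) (LinearMap.ker
      (LinearMap.lsmul (ZField k n Fq)[X] E.bar.Points (constPoly k n lam ^ m))) =
      (r * (m * (constPoly k n lam).natDegree) : ℕ) := fun m hm => by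
    obtain ⟨s, hs, hker, -⟩ := hc m hm
    rw [← (E.bar.kernelEquiv _).rank_eq, hker,
      E.bar.finrank_motive_quotient ha (pow_ne_zero m hp.ne_zero) hs, hp.natDegree_pow]
  obtain ⟨hfree, hfin, hr⟩ := hb
  let ι := E.pointsMap (incl f k n) (incl_tauf f k n)
  have hι : ∀ x, E.tauPow (ι x) = ι x := fun x => funext fun i => by
    change ((taubar f k n).toAlgHom ^ f.natDegree) (incl f k n (x i)) = incl f k n (x i)
    rw [← map_pow_comm (incl f k n) (incl_tauf f k n), tauf_pow]
  -- These are the powers of the root of `f` below `d`, placed in each of the `l` coordinates: `l *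
  -- d` vectors, matching the dimension of the cokernel of 1 - Φ.
  have hv : LinearIndependent (M := E.Points) (ZField k n Fq) _ :=
    linearIndependent_single_const f k n l
  obtain ⟨h1, h2, h3, P, Q, hP, hPQ, hQ, hM⟩ :=
    SemilinearPresentation.exists_charpoly_eval_one E.bar.presentation
      (taubar_symm_eq_self_iff f k n) hr (E.bar.mulXPow_presentation_S hd)
      (E.bar.presentation_ε_mulXPow hd) (E.bar.one_sub_mulXPow_injective hd hd0) hp
      (ZField.irreducible_map_const hlam hirr)
      (fun m hm => Module.finite_of_rank_eq_nat (hrank m hm))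
      (fun m hm => Module.finrank_eq_of_rank_eq (hrank m hm))
      ι (fun x y h => funext fun i => (incl f k n).injective (congrFun h i)) hι hv
      (by rw [E.bar.finrank_quotient_one_sub_mulXPow hd hd0]; simp)
  exact ⟨h1, h2, h3, P, hP, isOrder_C_mul hPQ hQ hM⟩
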